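/- Setting. Let $X,Y$ be nonempty finite sets and $A,B$ nonempty compact metric spaces. Let $p:X\times A\to\Delta(X)$ and $q:Y\times B\to\Delta(Y)$ be such that $p(x'|x,\cdot)$ and $q(y'|y,\cdot)$ are continuous, and let $u:X\times Y\times A\times B\to[0,1]$ be such that $u(x,y,\cdot,b)$ and $u(x,y,a,\cdot)$ are continuous. In the zero-sum product stochastic game $\Gamma=(X,Y,A,B,p,q,u)$, at each stage $n\ge 1$ both players observe the whole history (past states and actions, and the current state $(x_n,y_n)$) and simultaneously choose $a_n\in A$, $b_n\in B$; player 1 receives $u_n=u(x_n,y_n,a_n,b_n)$ from player 2, and $x_{n+1}$, $y_{n+1}$ are drawn independently from $p(\cdot|x_n,a_n)$ and $q(\cdot|y_n,b_n)$. (Behavior) strategies are measurable maps from joint histories to mixed actions. Write $\gamma_N(\sigma,\tau)(x,y)=\frac1N\sum_{n=1}^N\mathbb{E}^{x,y}_{\sigma,\tau}[u_n]$. The same definitions are used when player 2's action set depends on his current state. A number $v\in[0,1]$ is the uniform value of the game at an initial state $(x,y)$ if for every $\varepsilon>0$ there are a strategy $\sigma$ and $M\ge1$ such that $\gamma_N(\sigma,\tau)(x,y)\ge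 v-\varepsilon$ for all $\tau$ and all $N\ge M$, and there are a strategy $\tau$ and $M\ge 1$ such that $\gamma_N(\sigma,\tau)(x,y)\le v+\varepsilon$ for all $\sigma$ and all $N\ge M$. A strategy $\sigma$ (resp. $\tau$) with the first (resp. second) property for a given $\varepsilon$, for every initial state $(x,y)$ of the game (with $v$ the uniform value at $(x,y)$), is called $\varepsilon$-optimal. A strategy is Markov $N_0$-periodic if the mixed action it prescribes at stage $n$ depends only on the current state $(x_n,y_n)$ and on $n$ modulo $N_0$. Player 1 has the strong communication property if there is $T\ge1$ such that, for every behavior policy of player 1 depending only on his own past states and actions and his current state, and for all $x,x'\in X$, the state of player 1 at stage $T$ equals $x'$ with positive probability when his state at stage $1$ is $x$. A maximal communicating set is a subset $C\subseteq Y$ that is maximal for inclusion among the sets that are a recurrent class of the Markov chain on $Y$ induced by some stationary policy $\nu\in\Delta(B)^Y$. Let $C_1,\dots,C_L$ be the maximal communicating sets, and let $\Gamma_i=(X,C_i,A,(B_y)_{y\in C_i},p,q,u)$ be the game with player 2's states restricted to $C_i$ and his action set at $y\in C_i$ restricted to $B_y=\{b\in B : q(C_i|y,b)=1\}$. Proposition.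 Assume that player 1 has the strong communication property. Then for every $i\in\{1,\dots,L\}$ the game $\Gamma_i$ has a uniform value $v^i_\infty$ at every initial state, and it is constant over $X\times C_i$. Moreover, for every $\varepsilon>0$ there exists $N_0\ge1$ such that, for every $i\in\{1,\dots,L\}$, both players have an $\varepsilon$-optimal Markov $N_0$-periodic strategy in $\Gamma_i$. -/

import Mathlib

open MeasureTheory ProbabilityTheory

noncomputable section

/-- A behaviour rule in a controlled process with state space `S`, where in state `s` the element
of `K s` that is played is publicly recorded. Stages are numbered `0, 1, 2, …`, so the history at
stage `n` consists of the `n` past pairs (state, action) and the current state. At each stage `n`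
and current state `s` (`S` is finite and discrete) the rule chooses, measurably in the past, a
probability distribution on `K' s`. -/
structure Behavior (S : Type*) [MeasurableSpace S] (K K' : S → Type*)
    [∀ s, MeasurableSpace (K s)] [∀ s, MeasurableSpace (K' s)] where
  /-- The mixed action chosen at stage `n` in state `s`, given the past. -/
  act : (n : ℕ) → (s : S) → Kernel (Fin n → Σ s, K s) (K' s)
  isMarkov : ∀ n s, IsMarkovKernel (act n s)

namespace Behavior

variable {S : Type*} [MeasurableSpace S] {K K₁ K₂ : S → Type*}
  [∀ s, MeasurableSpace (K s)] [∀ s, MeasurableSpace (K₁ s)] [∀ s, MeasurableSpace (K₂ s)]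

/-- Two rules used simultaneously, with independent randomizations. -/
def prod (σ : Behavior S K K₁) (τ : Behavior S K K₂) :
    Behavior S K (fun s => K₁ s × K₂ s) where
  act n s := (σ.act n s) ×ₖ (τ.act n s)
  isMarkov n s := by
    have := σ.isMarkov n s
    have := τ.isMarkov n s
    infer_instance

/-- The rule depends only on the current state and on the stage modulo `N`. -/
def IsMarkovPeriodic (N : ℕ) (σ : Behavior S K K₁) : Prop :=
  ∃ μ : ℕ → (s : S) → ProbabilityMeasure (K₁ s),
    ∀ (n : ℕ) (s : S) (w : Fin n → Σ s, K s), σ.act n s w = (μ (n % N) s : Measure (K₁ s))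

end Behavior

/-- The law of the history at stage `n` of the process with initial state `s₀`, transition
probabilities `r s k s'` (from `s` to `s'` when `k` is played) and behaviour rule `π`. -/
def historyLaw {S : Type*} [Fintype S] [MeasurableSpace S] {K : S → Type*}
    [∀ s, MeasurableSpace (K s)] (r : (s : S) → K s → S → ℝ) (π : Behavior S K K) (s₀ : S) :
    (n : ℕ) → Measure ((Fin n → Σ s, K s) × S)
  | 0 => Measure.dirac (fun i => i.elim0, s₀)
  | n + 1 => (historyLaw r π s₀ n).bind fun h =>
      (π.act n h.2 h.1).bind fun k =>
        ∑ s' : S, ENNReal.ofReal (r h.2 k s') •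
          Measure.dirac ((Fin.snoc h.1 ⟨h.2, k⟩ : Fin (n + 1) → Σ s, K s), s')

/-- A state `s'` is accessible from `s` in the Markov chain with transition matrix `P`. -/
def Accessible {S : Type*} [Fintype S] [DecidableEq S] (P : Matrix S S ℝ) (s s' : S) : Prop :=
  ∃ t : ℕ, 0 < (P ^ t) s s'

/-- `C` is a recurrent class of the finite Markov chain with transition matrix `P`: it is nonempty
and the states accessible from any state of `C` are exactly the states of `C`. -/
def IsRecurrentClass {S : Type*} [Fintype S] [DecidableEq S] (P : Matrix S S ℝ)
    (C : Finset S) : Prop :=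
  C.Nonempty ∧ ∀ s ∈ C, ∀ s', s' ∈ C ↔ Accessible P s s'

/-- A zero-sum product stochastic game. Player 1 has state space `X` and action set `A`; player 2
has state space `Y` and action set `B y` in state `y`. The payoff `u` goes to player 1. -/
structure ProductGame (X Y A : Type*) (B : Y → Type*) [Fintype X] [Fintype Y]
    [TopologicalSpace A] [∀ y, TopologicalSpace (B y)] where
  /-- `p x a x'` is the probability of moving from `x` to `x'` under action `a`. -/
  p : X → A → X → ℝ
  /-- `q y b y'` is the probability of moving from `y` to `y'` under action `b`. -/
  q : (y : Y) → B y → Y → ℝ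
  /-- The stage payoff. -/
  u : X → (y : Y) → A → B y → ℝ
  p_nonneg : ∀ x a x', 0 ≤ p x a x'
  p_sum : ∀ x a, ∑ x', p x a x' = 1
  p_continuous : ∀ x x', Continuous fun a => p x a x'
  q_nonneg : ∀ y b y', 0 ≤ q y b y'
  q_sum : ∀ y b, ∑ y', q y b y' = 1
  q_continuous : ∀ y y', Continuous fun b => q y b y'
  u_mem : ∀ x y a b, u x y a b ∈ Set.Icc (0 : ℝ) 1
  u_continuous_left : ∀ x y b, Continuous fun a => u x y a b
  u_continuous_right : ∀ x y a, Continuous fun b => u x y a b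

namespace ProductGame

variable {X Y A : Type*} {B : Y → Type*} [Fintype X] [Fintype Y]
  [TopologicalSpace A] [∀ y, TopologicalSpace (B y)]

section Communication

/-- Player 1 has the strong communication property: for some `T ≥ 1`, whatever policy (depending
on his own history) he uses, the probability of being in `x'` at the `T`-th stage is positive, for
every initial state `x` and every `x'`. The `T`-th stage has `T - 1` past stages. -/
def StronglyCommunicating₁ [MeasurableSpace X] [MeasurableSpace A]
    (G : ProductGame X Y A B) : Prop :=
  ∃ T : ℕ, 1 ≤ T ∧ ∀ (σ : Behavior X (fun _ => A) (fun _ => A)) (x x' : X),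
    0 < historyLaw G.p σ x (T - 1) {h | h.2 = x'}

/-- The transition matrix on `Y` induced by a stationary policy `ν` of player 2. -/
def chain [∀ y, MeasurableSpace (B y)] (G : ProductGame X Y A B)
    (ν : (y : Y) → ProbabilityMeasure (B y)) : Matrix Y Y ℝ :=
  fun y y' => ∫ b, G.q y b y' ∂(ν y : Measure (B y))

/-- The maximal communicating sets of player 2: the sets that are maximal, for inclusion, among
the recurrent classes of the Markov chains induced by stationary policies on `Y`. -/
def IsMaximalCommunicating [DecidableEq Y] [∀ y, MeasurableSpace (B y)]
    (G : ProductGame X Y A B) (C : Finset Y) : Prop :=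
  Maximal (fun C' : Finset Y =>
    ∃ ν : (y : Y) → ProbabilityMeasure (B y), IsRecurrentClass (G.chain ν) C') C

/-- The actions of player 2 at state `y ∈ C` under which the state stays in `C` with
probability one. -/
abbrev StayAction (G : ProductGame X Y A B) (C : Finset Y) (y : C) : Type _ :=
  {b : B y // ∑ y' ∈ C, G.q y b y' = 1}

/-- The auxiliary game over `C`: player 2's states are those of `C` and in each of them he is
restricted to the actions that keep his state in `C`. -/
def restrict (G : ProductGame X Y A B) (C : Finset Y) :
    ProductGame X C A (G.StayAction C) where
  p := G.p
  q y b y' := G.q y b y'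
  u x y a b := G.u x y a b
  p_nonneg := G.p_nonneg
  p_sum := G.p_sum
  p_continuous := G.p_continuous
  q_nonneg y b y' := G.q_nonneg y b y'
  q_sum y b := by
    rw [Finset.sum_coe_sort C (fun y' => G.q y b y')]
    exact b.2
  q_continuous y y' := (G.q_continuous y y').comp continuous_subtype_val
  u_mem x y a b := G.u_mem x y a b
  u_continuous_left x y b := G.u_continuous_left x y b
  u_continuous_right x y a := (G.u_continuous_right x y a).comp continuous_subtype_val

end Communication

section Play

variable [MeasurableSpace X] [MeasurableSpace Y] [MeasurableSpace A] [∀ y, MeasurableSpace (B y)]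

/-- Behaviour strategies of player 1, depending on the joint history. -/
abbrev Strategy₁ (_G : ProductGame X Y A B) :=
  Behavior (X × Y) (fun s => A × B s.2) (fun _ => A)

/-- Behaviour strategies of player 2, depending on the joint history. -/
abbrev Strategy₂ (_G : ProductGame X Y A B) :=
  Behavior (X × Y) (fun s => A × B s.2) (fun s => B s.2)

/-- The joint transition probabilities. -/
def trans (G : ProductGame X Y A B) (s : X × Y) (k : A × B s.2) (s' : X × Y) : ℝ :=
  G.p s.1 k.1 s'.1 * G.q s.2 k.2 s'.2

/-- The expected payoff at stage `n` (stages being numbered from `0`). -/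
def expectedPayoff (G : ProductGame X Y A B) (σ : G.Strategy₁) (τ : G.Strategy₂) (s : X × Y)
    (n : ℕ) : ℝ :=
  ∫ h, ∫ k, G.u h.2.1 h.2.2 k.1 k.2 ∂((σ.prod τ).act n h.2 h.1)
    ∂(historyLaw G.trans (σ.prod τ) s n)

/-- The payoff `γ_N(σ, τ)(s)` of the `N`-stage game starting in `s`. -/
def payoff (G : ProductGame X Y A B) (N : ℕ) (σ : G.Strategy₁) (τ : G.Strategy₂)
    (s : X × Y) : ℝ :=
  1 / (N : ℝ) * ∑ n ∈ Finset.range N, G.expectedPayoff σ τ s n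

/-- `σ` guarantees `v - ε` to player 1 from `s` in all sufficiently long games. When `v` is the
uniform value at `s`, this says that `σ` is uniformly `ε`-optimal from `s`. -/
def IsOptimal₁ (G : ProductGame X Y A B) (ε v : ℝ) (s : X × Y) (σ : G.Strategy₁) : Prop :=
  ∃ M : ℕ, 1 ≤ M ∧ ∀ (τ : G.Strategy₂) (N : ℕ), M ≤ N → v - ε ≤ G.payoff N σ τ s

/-- `τ` guarantees `v + ε` to player 2 from `s` in all sufficiently long games. When `v` is the
uniform value at `s`, this says that `τ` is uniformly `ε`-optimal from `s`. -/
def IsOptimal₂ (G : ProductGame X Y A B) (ε v : ℝ) (s : X × Y) (τ : G.Strategy₂) : Prop :=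
  ∃ M : ℕ, 1 ≤ M ∧ ∀ (σ : G.Strategy₁) (N : ℕ), M ≤ N → G.payoff N σ τ s ≤ v + ε

/-- `v` is the uniform value of the game starting in `s`: both players uniformly guarantee `v`. -/
def IsUniformValue (G : ProductGame X Y A B) (s : X × Y) (v : ℝ) : Prop :=
  v ∈ Set.Icc (0 : ℝ) 1 ∧
    (∀ ε : ℝ, 0 < ε → ∃ σ : G.Strategy₁, G.IsOptimal₁ ε v s σ) ∧
    (∀ ε : ℝ, 0 < ε → ∃ τ : G.Strategy₂, G.IsOptimal₂ ε v s τ)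

end Play

end ProductGame

end

/-! The proof is a vanishing-discount argument producing stationary strategies, so the period is 1.
For a discount factor `l`, the Shapley operator with continuation `(1 - l) * V` is a contraction,
and its fixed point `V` is the unnormalized discounted value.

If `l * V` is nearly constant, `V` serves as a potential: one-shot optimal actions for continuation
`(1 - l) * V`, played in every stage, make the payoff plus the increment of `V` at least (resp. at
most) about `l * V` in expectation. Telescoping leaves only the bounded boundary values of `V`,
which vanish after division by `N`, so the guarantee is uniform in the horizon
(`exists_stationary₁`, `exists_stationary₂`).

It remains to bound the oscillation of `V` independently of `l` (`exists_oscillation_bound`). It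
suffices that player 2 alone can force a visit to any joint state with positive probability: then
the largest value exceeds any other by at most a time divided by a probability. In a recurrent class
player 2 uses the policy inducing it. Transitions are independent, so the probability of reaching a
pair is at least his own probability times the minimum over player 1's behaviour (`minReach`).
Strong communication makes the latter positive at all late times, so no aperiodicity of player 2's
chain is needed (`StronglyCommunicating₁.exists_reach`). -/

section Minimax

/-! ### One-shot games: a minimax theorem for separately continuous payoffs. -/

set_option linter.unusedSectionVars false

/-- A compact convex set of payoff vectors in which every weighted average can be brought down
to `w` contains a vector all of whose coordinates are at most `w`. -/
theorem exists_forall_le_of_forall_stdSimplex {ι : Type*} [Fintype ι] {K : Set (ι → ℝ)}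
    (hne : K.Nonempty) (hc : IsCompact K) (hK : Convex ℝ K) {w : ℝ}
    (h : ∀ c ∈ stdSimplex ℝ ι, ∀ δ : ℝ, 0 < δ → ∃ z ∈ K, ∑ i, c i * z i < w + δ) :
    ∃ z ∈ K, ∀ i, z i ≤ w := by
  classical
  by_contra! hcon
  have hO : Convex ℝ {z : ι → ℝ | ∀ i, z i ≤ w} := by
    have : {z : ι → ℝ | ∀ i, z i ≤ w} = Set.Iic (fun _ => w) := by
      ext z; simp [Pi.le_def]
    rw [this]; exact convex_Iic _
  have hOc : IsClosed {z : ι → ℝ | ∀ i, z i ≤ w} := by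
    have : {z : ι → ℝ | ∀ i, z i ≤ w} = Set.Iic (fun _ => w) := by
      ext z; simp [Pi.le_def]
    rw [this]; exact isClosed_Iic
  have hdisj : Disjoint {z : ι → ℝ | ∀ i, z i ≤ w} K := by
    rw [Set.disjoint_left]
    intro z hz hzK
    obtain ⟨i, hi⟩ := hcon z hzK
    exact absurd (hz i) (not_le.2 hi)
  -- The separating functional has nonnegative coefficients because the orthant is unbounded below;
  -- once normalized they form a weight vector contradicting `h`.
  obtain ⟨f, u, v, hfO, huv, hfK⟩ := geometric_hahn_banach_closed_compact hO hOc hK hc hdisj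
  set c : ι → ℝ := fun i => f (Pi.single i 1) with hcdef
  have hf : ∀ z : ι → ℝ, f z = ∑ i, c i * z i := by
    intro z
    have := congrArg f (pi_eq_sum_univ' z)
    rw [this, map_sum]
    refine Finset.sum_congr rfl fun i _ => ?_
    rw [map_smul, smul_eq_mul, mul_comm]
  have hc0 : ∀ i, 0 ≤ c i := by
    intro i
    by_contra! hi
    have hw := hfO (fun _ => w) (fun _ => le_rfl)
    -- Moving down by `t` along coordinate `i` brings `f` exactly to `u`, against the strict bound
    -- `hfO`.
    set t : ℝ := (u - f fun _ => w) / (-c i) with ht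
    have ht0 : 0 ≤ t := div_nonneg (by linarith) (by linarith)
    have := hfO ((fun _ => w) - t • Pi.single i 1) (by
      intro j
      by_cases hj : j = i
      · subst hj; simp [ht0]
      · simp [hj])
    rw [map_sub, map_smul, smul_eq_mul] at this
    have e : t * f (Pi.single i 1) = -(u - f fun _ => w) := by
      change t * c i = _
      rw [ht, div_mul_eq_mul_div, div_eq_iff (by linarith)]; ring
    linarith
  have hw : w * ∑ i, c i < u := by
    have := hfO (fun _ => w) (fun _ => le_rfl)
    rw [hf, ← Finset.sum_mul] at this
    linarith
  have hS : 0 < ∑ i, c i := by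
    refine lt_of_le_of_ne (Finset.sum_nonneg fun i _ => hc0 i) fun h0 => ?_
    have hz : ∀ i, c i = 0 := fun i =>
      (Finset.sum_eq_zero_iff_of_nonneg fun i _ => hc0 i).1 h0.symm i (Finset.mem_univ i)
    obtain ⟨z, hz'⟩ := hne
    have := hfK z hz'
    rw [hf] at this
    simp only [hz, zero_mul, Finset.sum_const_zero, mul_zero] at this hw
    linarith
  obtain ⟨z, hz, hlt⟩ := h (fun i => c i / ∑ i, c i)
    ⟨fun i => div_nonneg (hc0 i) hS.le, by rw [← Finset.sum_div, div_self hS.ne']⟩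
    (v / (∑ i, c i) - w) (by rw [sub_pos, lt_div_iff₀ hS]; linarith)
  have h1 := hfK z hz
  rw [hf] at h1
  have h2 : ∑ i, c i / (∑ i, c i) * z i = (∑ i, c i * z i) / ∑ i, c i := by
    rw [Finset.sum_div]; exact Finset.sum_congr rfl fun i _ => by ring
  rw [h2, add_sub_cancel, div_lt_div_iff_of_pos_right hS] at hlt
  linarith

theorem exists_probabilityMeasure_integral_eq_sum {ι B : Type*} [Fintype ι] [MeasurableSpace B]
    (w : ι → ℝ) (hw : w ∈ stdSimplex ℝ ι) (b : ι → B) :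
    ∃ ν : ProbabilityMeasure B, ∀ f : B → ℝ, Measurable f →
      ∫ x, f x ∂(ν : Measure B) = ∑ i, w i * f (b i) := by
  refine ⟨⟨∑ i, ENNReal.ofReal (w i) • Measure.dirac (b i), ⟨?_⟩⟩, fun f hf => ?_⟩
  · simp only [Measure.coe_finsetSum, Measure.coe_smul, Finset.sum_apply, Pi.smul_apply,
      measure_univ, smul_eq_mul, mul_one]
    rw [← ENNReal.ofReal_sum_of_nonneg fun i _ => hw.1 i, hw.2, ENNReal.ofReal_one]
  · change ∫ x, f x ∂(∑ i, ENNReal.ofReal (w i) • Measure.dirac (b i)) = _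
    have hd : ∀ y, ∫ x, f x ∂(Measure.dirac y) = f y := fun y =>
      integral_dirac' f y hf.stronglyMeasurable
    rw [integral_finsetSum_measure]
    · refine Finset.sum_congr rfl fun i _ => ?_
      rw [integral_smul_measure, hd, ENNReal.toReal_ofReal (hw.1 i), smul_eq_mul]
    · intro i _
      refine Integrable.smul_measure ?_ ENNReal.ofReal_ne_top
      exact integrable_dirac' hf.stronglyMeasurable (by simp)

theorem exists_probabilityMeasure_integral_convexCombination {B : Type*} [MeasurableSpace B]
    {s t : ℝ} (hs : 0 ≤ s) (ht : 0 ≤ t) (hst : s + t = 1) (ν₁ ν₂ : ProbabilityMeasure B) :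
    ∃ ν : ProbabilityMeasure B, ∀ f : B → ℝ, Integrable f (ν₁ : Measure B) →
      Integrable f (ν₂ : Measure B) → ∫ x, f x ∂(ν : Measure B) =
        s * ∫ x, f x ∂(ν₁ : Measure B) + t * ∫ x, f x ∂(ν₂ : Measure B) := by
  refine ⟨⟨ENNReal.ofReal s • (ν₁ : Measure B) + ENNReal.ofReal t • (ν₂ : Measure B), ⟨?_⟩⟩,
    fun f h₁ h₂ => ?_⟩
  · simp [← ENNReal.ofReal_add hs ht, hst]
  · change ∫ x, f x ∂(ENNReal.ofReal s • (ν₁ : Measure B) + ENNReal.ofReal t • (ν₂ : Measure B)) = _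
    rw [integral_add_measure (h₁.smul_measure ENNReal.ofReal_ne_top)
      (h₂.smul_measure ENNReal.ofReal_ne_top), integral_smul_measure, integral_smul_measure,
      ENNReal.toReal_ofReal hs, ENNReal.toReal_ofReal ht, smul_eq_mul, smul_eq_mul]

variable {A B : Type*} [TopologicalSpace A] [MeasurableSpace A]
  [TopologicalSpace B] [MeasurableSpace B]

/-- The supremum of what player 1 can guarantee with a mixed action in the one-shot game with
payoff `g`. -/
noncomputable def mixedValue (g : A → B → ℝ) : ℝ :=
  sSup {t : ℝ | ∃ μ : ProbabilityMeasure A, ∀ b, t ≤ ∫ a, g a b ∂(μ : Measure A)}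

/-- Separately continuous bounded payoff functions of a one-shot game. -/
structure IsOneShotPayoff (g : A → B → ℝ) : Prop where
  left : ∀ b, Continuous fun a => g a b
  right : ∀ a, Continuous (g a)
  bounded : ∃ K, ∀ a b, |g a b| ≤ K

section Continuous

variable [CompactSpace A] [OpensMeasurableSpace A] {f : A → ℝ}

theorem Continuous.integrable_of_compactSpace (hf : Continuous f) (μ : Measure A)
    [IsFiniteMeasure μ] : Integrable f μ :=
  hf.integrable_of_hasCompactSupport (HasCompactSupport.of_compactSpace f)

theorem Continuous.integral_probabilityMeasure (hf : Continuous f) :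
    Continuous fun μ : ProbabilityMeasure A => ∫ a, f a ∂(μ : Measure A) :=
  ProbabilityMeasure.continuous_integral_boundedContinuousFunction
    (BoundedContinuousFunction.mkOfCompact ⟨f, hf⟩)

theorem Continuous.integral_le_of_forall_le (hf : Continuous f) {K : ℝ} (hK : ∀ a, f a ≤ K)
    (μ : Measure A) [IsProbabilityMeasure μ] : ∫ a, f a ∂μ ≤ K := by
  have := integral_mono (hf.integrable_of_compactSpace μ) (integrable_const K) hK
  simpa using this

end Continuous

namespace IsOneShotPayoff

variable [CompactSpace A] [BorelSpace A] {g g' : A → B → ℝ}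

theorem bddAbove [Nonempty B] (hg : IsOneShotPayoff g) :
    BddAbove {t : ℝ | ∃ μ : ProbabilityMeasure A, ∀ b, t ≤ ∫ a, g a b ∂(μ : Measure A)} := by
  obtain ⟨K, hK⟩ := hg.bounded
  obtain ⟨b⟩ := ‹Nonempty B›
  refine ⟨K, ?_⟩
  rintro t ⟨μ, ht⟩
  exact (ht b).trans
    ((hg.left b).integral_le_of_forall_le (fun a => (le_abs_self _).trans (hK a b)) _)

theorem set_nonempty [Nonempty A] (hg : IsOneShotPayoff g) :
    {t : ℝ | ∃ μ : ProbabilityMeasure A, ∀ b, t ≤ ∫ a, g a b ∂(μ : Measure A)}.Nonempty := by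
  obtain ⟨K, hK⟩ := hg.bounded
  obtain ⟨a⟩ := ‹Nonempty A›
  refine ⟨-K, ⟨Measure.dirac a, inferInstance⟩, fun b => ?_⟩
  change _ ≤ ∫ x, g x b ∂(Measure.dirac a)
  rw [integral_dirac' _ _ (hg.left b).measurable.stronglyMeasurable]
  exact neg_le_of_abs_le (hK a b)

theorem exists_guarantee_left [Nonempty A] (hg : IsOneShotPayoff g) {ε : ℝ} (hε : 0 < ε) :
    ∃ μ : ProbabilityMeasure A, ∀ b, mixedValue g - ε ≤ ∫ a, g a b ∂(μ : Measure A) := by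
  obtain ⟨t, ⟨μ, hμ⟩, ht⟩ := exists_lt_of_lt_csSup hg.set_nonempty
    (show mixedValue g - ε < sSup _ from sub_lt_self _ hε)
  exact ⟨μ, fun b => ht.le.trans (hμ b)⟩

/-- This monotonicity and translation bound makes the Shapley operator nonexpansive in the sup norm.
-/
theorem mixedValue_le_add [Nonempty A] [Nonempty B] (hg : IsOneShotPayoff g)
    (hg' : IsOneShotPayoff g') {d : ℝ} (h : ∀ a b, g a b ≤ g' a b + d) :
    mixedValue g ≤ mixedValue g' + d := by
  refine csSup_le hg.set_nonempty ?_
  rintro t ⟨μ, hμ⟩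
  rw [← sub_le_iff_le_add]
  refine le_csSup hg'.bddAbove ⟨μ, fun b => ?_⟩
  rw [sub_le_iff_le_add]
  refine (hμ b).trans ?_
  have hi := (hg'.left b).integrable_of_compactSpace (μ : Measure A)
  have := integral_mono ((hg.left b).integrable_of_compactSpace (μ : Measure A))
    (hi.add (integrable_const d)) (fun a => h a b)
  rw [Pi.add_def, integral_add hi (integrable_const d)] at this
  simpa using this

variable [BorelSpace B]

theorem measurable_uncurry [TopologicalSpace.MetrizableSpace A] [SecondCountableTopology A]
    (hg : IsOneShotPayoff g) : Measurable (Function.uncurry g) :=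
  measurable_uncurry_of_continuous_of_measurable hg.left fun a => (hg.right a).measurable

theorem integrable_uncurry [TopologicalSpace.MetrizableSpace A] [SecondCountableTopology A]
    (hg : IsOneShotPayoff g) (ρ : Measure (A × B)) [IsFiniteMeasure ρ] :
    Integrable (Function.uncurry g) ρ := by
  obtain ⟨K, hK⟩ := hg.bounded
  exact Integrable.of_bound hg.measurable_uncurry.aestronglyMeasurable K
    (Filter.Eventually.of_forall fun x => hK x.1 x.2)

/-- The easy half of minimax: integrate both guarantees against the product measure and apply
Fubini. -/
theorem mixedValue_le [TopologicalSpace.MetrizableSpace A] [SecondCountableTopology A]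
    [Nonempty A] (hg : IsOneShotPayoff g) {t : ℝ} (ν : Measure B) [IsProbabilityMeasure ν]
    (h : ∀ a, ∫ b, g a b ∂ν ≤ t) : mixedValue g ≤ t := by
  refine csSup_le hg.set_nonempty ?_
  rintro s ⟨μ, hμ⟩
  have hi := hg.integrable_uncurry ((μ : Measure A).prod ν)
  calc s = ∫ _, s ∂ν := by simp
    _ ≤ ∫ b, ∫ a, g a b ∂(μ : Measure A) ∂ν :=
      integral_mono (integrable_const s) hi.integral_prod_right hμ
    _ = ∫ a, ∫ b, g a b ∂ν ∂(μ : Measure A) := (integral_integral_swap hi).symm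
    _ ≤ ∫ _, t ∂(μ : Measure A) := integral_mono hi.integral_prod_left (integrable_const t) h
    _ = t := by simp

variable [CompactSpace B]

/-- The payoff vectors on `F` achievable by mixed actions of player 2 form a weakly compact convex
image. Weights on `F` are a mixed action of player 1, so some pure reply keeps the weighted payoff
below `mixedValue g + δ`. -/
theorem exists_guarantee_right_finset [T2Space B] [Nonempty B] (hg : IsOneShotPayoff g)
    (F : Finset A) :
    ∃ ν : ProbabilityMeasure B, ∀ a ∈ F, ∫ b, g a b ∂(ν : Measure B) ≤ mixedValue g := by
  set Φ : ProbabilityMeasure B → F → ℝ := fun ν a => ∫ b, g a b ∂(ν : Measure B) with hΦ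
  have hΦc : Continuous Φ := continuous_pi fun a => (hg.right a).integral_probabilityMeasure
  obtain ⟨b₀⟩ := ‹Nonempty B›
  obtain ⟨z, ⟨ν, rfl⟩, hz⟩ := exists_forall_le_of_forall_stdSimplex (K := Set.range Φ)
    ⟨_, ⟨Measure.dirac b₀, inferInstance⟩, rfl⟩ (isCompact_range hΦc) (by
      rintro _ ⟨ν₁, rfl⟩ _ ⟨ν₂, rfl⟩ s t hs ht hst
      obtain ⟨ν, hν⟩ := exists_probabilityMeasure_integral_convexCombination hs ht hst ν₁ ν₂
      exact ⟨ν, funext fun a => hν _ ((hg.right a).integrable_of_compactSpace _)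
        ((hg.right a).integrable_of_compactSpace _)⟩)
    (w := mixedValue g) (by
      intro c hc δ hδ
      obtain ⟨μ, hμ⟩ := exists_probabilityMeasure_integral_eq_sum c hc (fun a : F => (a : A))
      by_contra! hcon
      have : mixedValue g + δ ≤ mixedValue g := le_csSup hg.bddAbove ⟨μ, fun b => by
        rw [hμ _ (hg.left b).measurable]
        refine (hcon _ ⟨⟨Measure.dirac b, inferInstance⟩, rfl⟩).trans_eq ?_
        refine Finset.sum_congr rfl fun a _ => ?_
        change _ * ∫ b, g a b ∂(Measure.dirac b) = _
        rw [integral_dirac' _ _ (hg.right a).measurable.stronglyMeasurable]⟩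
      linarith)
  exact ⟨ν, fun a ha => hz ⟨a, ha⟩⟩

/-- Player 2 has an optimal mixed action in the one-shot game. -/
theorem exists_guarantee_right [T2Space B] [Nonempty B] (hg : IsOneShotPayoff g) :
    ∃ ν : ProbabilityMeasure B, ∀ a, ∫ b, g a b ∂(ν : Measure B) ≤ mixedValue g := by
  -- Finite intersection property in the weakly compact space of mixed actions; each constraint is
  -- closed since `g a` is continuous.
  have := isCompact_univ.inter_iInter_nonempty
    (fun a => {ν : ProbabilityMeasure B | ∫ b, g a b ∂(ν : Measure B) ≤ mixedValue g})
    (fun a => isClosed_le (hg.right a).integral_probabilityMeasure continuous_const) (by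
      intro F
      obtain ⟨ν, hν⟩ := hg.exists_guarantee_right_finset F
      exact ⟨ν, Set.mem_univ _, by simpa using hν⟩)
  obtain ⟨ν, -, hν⟩ := this
  exact ⟨ν, by simpa using hν⟩

end IsOneShotPayoff

end Minimax

/-! ### Laws of histories and the potential inequality. -/

section Play

theorem measurable_sigmaMk {S : Type*} {K : S → Type*} [∀ s, MeasurableSpace (K s)] (s : S) :
    Measurable (Sigma.mk s : K s → Σ s, K s) :=
  Measurable.of_le_map (iInf_le _ s)

variable {S : Type*} [Fintype S] [MeasurableSpace S] [DiscreteMeasurableSpace S] {K : S → Type*}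
  [∀ s, MeasurableSpace (K s)]

/-- Measurable transition probabilities. -/
structure IsTransition (r : (s : S) → K s → S → ℝ) : Prop where
  nonneg : ∀ s k s', 0 ≤ r s k s'
  sum_eq_one : ∀ s k, ∑ s', r s k s' = 1
  measurable : ∀ s s', Measurable fun k => r s k s'

theorem measurable_finSnoc {α : Type*} [MeasurableSpace α] (n : ℕ) :
    Measurable fun p : (Fin n → α) × α => (Fin.snoc p.1 p.2 : Fin (n + 1) → α) := by
  refine measurable_pi_iff.2 fun i => ?_
  refine Fin.lastCases ?_ (fun j => ?_) i
  · simpa using measurable_snd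
  · simpa [Function.comp_def] using (measurable_pi_apply j).comp measurable_fst

theorem ProbabilityTheory.integral_bind_kernel {α β : Type*} [MeasurableSpace α]
    [MeasurableSpace β] (μ : Measure α) [SFinite μ] (κ : Kernel α β) [IsSFiniteKernel κ] {f : β → ℝ}
    (hf : Integrable f (μ.bind κ)) : ∫ y, f y ∂(μ.bind κ) = ∫ x, ∫ y, f y ∂(κ x) ∂μ := by
  rw [Measure.comp_eq_comp_const_apply] at hf ⊢
  rw [Kernel.integral_comp hf, Kernel.const_apply]

variable {r : (s : S) → K s → S → ℝ}

/-- The law of the next history, given the past, the current state and the current action. -/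
noncomputable def actionKernel (hr : IsTransition r) (n : ℕ) (s : S) :
    Kernel ((Fin n → Σ s, K s) × K s) ((Fin (n + 1) → Σ s, K s) × S) where
  toFun p := ∑ s' : S, ENNReal.ofReal (r s p.2 s') •
    Measure.dirac ((Fin.snoc p.1 ⟨s, p.2⟩ : Fin (n + 1) → Σ s, K s), s')
  measurable' := by
    refine Measure.measurable_of_measurable_coe _ fun t ht => ?_
    simp only [Measure.coe_finsetSum, Finset.sum_apply, Measure.smul_apply, smul_eq_mul]
    refine Finset.measurable_sum _ fun s' _ => Measurable.mul ?_ ?_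
    · exact ((hr.measurable s s').comp measurable_snd).ennreal_ofReal
    · refine (Measure.measurable_coe ht).comp (Measure.measurable_dirac.comp ?_)
      exact ((measurable_finSnoc n).comp
        (measurable_fst.prodMk ((measurable_sigmaMk s).comp measurable_snd))).prodMk
        measurable_const

instance (hr : IsTransition r) (n : ℕ) (s : S) : IsMarkovKernel (actionKernel hr n s) := by
  refine ⟨fun p => ⟨?_⟩⟩
  change (∑ s' : S, ENNReal.ofReal (r s p.2 s') • Measure.dirac
    ((Fin.snoc p.1 ⟨s, p.2⟩ : Fin (n + 1) → Σ s, K s), s')) _ = 1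
  simp only [Measure.coe_finsetSum, Measure.coe_smul, Finset.sum_apply, Pi.smul_apply,
      measure_univ, smul_eq_mul, mul_one]
  rw [← ENNReal.ofReal_sum_of_nonneg fun i _ => hr.nonneg _ _ _, hr.sum_eq_one, ENNReal.ofReal_one]

theorem integral_actionKernel (hr : IsTransition r) (n : ℕ) (s : S)
    (p : (Fin n → Σ s, K s) × K s) (f : S → ℝ) :
    ∫ h, f h.2 ∂(actionKernel hr n s p) = ∑ s', r s p.2 s' * f s' := by
  have hf : StronglyMeasurable fun h : (Fin (n + 1) → Σ s, K s) × S => f h.2 :=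
    ((measurable_of_countable f).comp measurable_snd).stronglyMeasurable
  change ∫ h, f h.2 ∂(∑ s' : S, ENNReal.ofReal (r s p.2 s') • Measure.dirac
    ((Fin.snoc p.1 ⟨s, p.2⟩ : Fin (n + 1) → Σ s, K s), s')) = _
  rw [integral_finsetSum_measure]
  · refine Finset.sum_congr rfl fun s' _ => ?_
    rw [integral_smul_measure, integral_dirac' _ _ hf, ENNReal.toReal_ofReal (hr.nonneg _ _ _),
      smul_eq_mul]
  · intro s' _
    exact (integrable_dirac' hf (by simp)).smul_measure ENNReal.ofReal_ne_top

/-- The law of the next history, given the current history. -/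
noncomputable def stepKernel (hr : IsTransition r) (π : Behavior S K K) (n : ℕ) :
    Kernel ((Fin n → Σ s, K s) × S) ((Fin (n + 1) → Σ s, K s) × S) where
  toFun h := (π.act n h.2 h.1).bind fun k => actionKernel hr n h.2 (h.1, k)
  measurable' := by
    refine measurable_from_prod_countable_left fun s => ?_
    refine Measure.measurable_of_measurable_coe _ fun t ht => ?_
    have := π.isMarkov n s
    have hm : Measurable fun p : (Fin n → Σ s, K s) × K s => actionKernel hr n s p t :=
      (Measure.measurable_coe ht).comp (actionKernel hr n s).measurable
    have : (fun w => ((π.act n s w).bind fun k => actionKernel hr n s (w, k)) t) =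
        fun w => ∫⁻ k, actionKernel hr n s (w, k) t ∂(π.act n s w) := by
      ext w
      exact Measure.bind_apply ht
        ((actionKernel hr n s).measurable.comp measurable_prodMk_left).aemeasurable
    simp only
    rw [this]
    exact hm.lintegral_kernel_prod_right'

theorem stepKernel_apply (hr : IsTransition r) (π : Behavior S K K) (n : ℕ)
    (h : (Fin n → Σ s, K s) × S) : stepKernel hr π n h =
      (π.act n h.2 h.1).bind ((actionKernel hr n h.2).sectR h.1) := rfl

instance (hr : IsTransition r) (π : Behavior S K K) (n : ℕ) :
    IsMarkovKernel (stepKernel hr π n) := by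
  refine ⟨fun h => ?_⟩
  have := π.isMarkov n h.2
  rw [stepKernel_apply]
  infer_instance

theorem historyLaw_succ (hr : IsTransition r) (π : Behavior S K K) (s₀ : S) (n : ℕ) :
    historyLaw r π s₀ (n + 1) = (historyLaw r π s₀ n).bind (stepKernel hr π n) := rfl

theorem isProbabilityMeasure_historyLaw (hr : IsTransition r) (π : Behavior S K K) (s₀ : S)
    (n : ℕ) : IsProbabilityMeasure (historyLaw r π s₀ n) := by
  induction n with
  | zero => exact inferInstanceAs (IsProbabilityMeasure (Measure.dirac _))
  | succ n ih => rw [historyLaw_succ hr]; infer_instance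

theorem integrable_state {α : Type*} [MeasurableSpace α] (μ : Measure (α × S)) [IsFiniteMeasure μ]
    (f : S → ℝ) : Integrable (fun h => f h.2) μ := by
  obtain ⟨C, hC⟩ := (Set.finite_range fun s => ‖f s‖).bddAbove
  exact Integrable.of_bound
    ((measurable_of_countable f).comp measurable_snd).aestronglyMeasurable C
    (Filter.Eventually.of_forall fun h => hC ⟨h.2, rfl⟩)

/-- One-step conditioning. Functions of the current state suffice, since every potential used below
depends on the state alone. -/
theorem integral_historyLaw_succ (hr : IsTransition r) (π : Behavior S K K) (s₀ : S) (n : ℕ)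
    (f : S → ℝ) : ∫ h, f h.2 ∂(historyLaw r π s₀ (n + 1)) =
      ∫ h, ∫ k, ∑ s', r h.2 k s' * f s' ∂(π.act n h.2 h.1) ∂(historyLaw r π s₀ n) := by
  have := isProbabilityMeasure_historyLaw hr π s₀ n
  have := isProbabilityMeasure_historyLaw hr π s₀ (n + 1)
  rw [historyLaw_succ hr, integral_bind_kernel _ _ (integrable_state _ f)]
  refine integral_congr_ae (Filter.Eventually.of_forall fun h => ?_)
  have := π.isMarkov n h.2
  simp only [stepKernel_apply]
  rw [integral_bind_kernel _ _ (integrable_state _ f)]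
  refine integral_congr_ae (Filter.Eventually.of_forall fun k => ?_)
  exact integral_actionKernel hr n h.2 (h.1, k) f

theorem integrable_integral_act (π : Behavior S K K) (n : ℕ)
    (μ : Measure ((Fin n → Σ s, K s) × S)) [IsFiniteMeasure μ] {U : (s : S) → K s → ℝ}
    (hU : ∀ s, Measurable (U s)) {C : ℝ} (hC : ∀ s k, |U s k| ≤ C) :
    Integrable (fun h => ∫ k, U h.2 k ∂(π.act n h.2 h.1)) μ := by
  refine Integrable.of_bound (C := C) ?_ (Filter.Eventually.of_forall fun h => ?_)
  · refine Measurable.aestronglyMeasurable (measurable_from_prod_countable_left fun s => ?_)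
    exact ((hU s).stronglyMeasurable.integral_kernel (κ := π.act n s)).measurable
  · have := π.isMarkov n h.2
    refine (norm_integral_le_of_norm_le_const (Filter.Eventually.of_forall (hC h.2))).trans ?_
    simp

/-- If the current payoff plus the expected potential of the next state always exceeds the
current potential by at least `c`, the total payoff grows at least at rate `c`. -/
theorem add_le_sum_of_potential (hr : IsTransition r) (π : Behavior S K K) (s₀ : S)
    {U : (s : S) → K s → ℝ} (hU : ∀ s, Measurable (U s)) {C : ℝ} (hC : ∀ s k, |U s k| ≤ C)
    (φ : S → ℝ) {c : ℝ}
    (h : ∀ n (h : (Fin n → Σ s, K s) × S), c + φ h.2 ≤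
      ∫ k, U h.2 k + ∑ s', r h.2 k s' * φ s' ∂(π.act n h.2 h.1)) (N : ℕ) :
    N * c + φ s₀ ≤ ∑ n ∈ Finset.range N,
      ∫ h, ∫ k, U h.2 k ∂(π.act n h.2 h.1) ∂(historyLaw r π s₀ n) +
        ∫ h, φ h.2 ∂(historyLaw r π s₀ N) := by
  induction N with
  | zero =>
    have hφ : StronglyMeasurable fun h : (Fin 0 → Σ s, K s) × S => φ h.2 :=
      ((measurable_of_countable φ).comp measurable_snd).stronglyMeasurable
    simp only [historyLaw, Finset.range_zero, Finset.sum_empty, integral_dirac' _ _ hφ]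
    simp
  | succ N ih =>
    have := isProbabilityMeasure_historyLaw hr π s₀ N
    obtain ⟨D, hD⟩ := (Set.finite_range fun s => |φ s|).bddAbove
    have hm : ∀ s, Measurable fun k => ∑ s', r s k s' * φ s' := fun s =>
      Finset.measurable_sum _ fun s' _ => (hr.measurable s s').mul_const _
    have hb : ∀ s k, |∑ s', r s k s' * φ s'| ≤ D := fun s k => by
      calc |∑ s', r s k s' * φ s'| ≤ ∑ s', |r s k s' * φ s'| := Finset.abs_sum_le_sum_abs _ _
        _ ≤ ∑ s', r s k s' * D := Finset.sum_le_sum fun s' _ => by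
          rw [abs_mul, abs_of_nonneg (hr.nonneg s k s')]
          exact mul_le_mul_of_nonneg_left (hD ⟨s', rfl⟩) (hr.nonneg s k s')
        _ = D := by rw [← Finset.sum_mul, hr.sum_eq_one, one_mul]
    have i₁ := integrable_integral_act π N (historyLaw r π s₀ N) hU hC
    have i₂ := integrable_integral_act π N (historyLaw r π s₀ N) hm hb
    have key := integral_mono ((integrable_const c).add (integrable_state _ φ)) (i₁.add i₂)
      (fun h' => by
        have := π.isMarkov N h'.2
        refine (h N h').trans_eq ?_
        exact integral_add
          (Integrable.of_bound (hU _).aestronglyMeasurable C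
            (Filter.Eventually.of_forall (hC _)))
          (Integrable.of_bound (hm _).aestronglyMeasurable D
            (Filter.Eventually.of_forall (hb _))))
    rw [Pi.add_def, Pi.add_def, integral_add (integrable_const c) (integrable_state _ φ),
      integral_add i₁ i₂, ← integral_historyLaw_succ hr] at key
    simp only [integral_const, probReal_univ, one_smul] at key
    rw [Finset.sum_range_succ]
    push_cast
    linarith

end Play

/-! ### Shapley operator and discounted values. -/

section Stationary

set_option linter.unusedSectionVars false

namespace ProductGame

variable {X Y A : Type*} {B : Y → Type*} [Fintype X] [Fintype Y]
  [TopologicalSpace A] [∀ y, TopologicalSpace (B y)]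

/-- The payoff of the one-shot game in state `s` in which the continuation payoff is `f`. -/
noncomputable def oneShot (G : ProductGame X Y A B) (f : X × Y → ℝ) (s : X × Y) (a : A)
    (b : B s.2) : ℝ :=
  G.u s.1 s.2 a b + ∑ s' : X × Y, G.p s.1 a s'.1 * G.q s.2 b s'.2 * f s'

variable (G : ProductGame X Y A B)

theorem sum_p_mul_q (s : X × Y) (a : A) (b : B s.2) :
    ∑ s' : X × Y, G.p s.1 a s'.1 * G.q s.2 b s'.2 = 1 := by
  rw [Fintype.sum_prod_type]
  simp [← Finset.mul_sum, G.q_sum, G.p_sum]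

theorem p_mul_q_nonneg (s s' : X × Y) (a : A) (b : B s.2) :
    0 ≤ G.p s.1 a s'.1 * G.q s.2 b s'.2 :=
  mul_nonneg (G.p_nonneg _ _ _) (G.q_nonneg _ _ _)

theorem sum_p_mul_q_le {f : X × Y → ℝ} {d : ℝ} (hf : ∀ s, f s ≤ d) (s : X × Y) (a : A)
    (b : B s.2) : ∑ s' : X × Y, G.p s.1 a s'.1 * G.q s.2 b s'.2 * f s' ≤ d :=
  calc _ ≤ ∑ s' : X × Y, G.p s.1 a s'.1 * G.q s.2 b s'.2 * d :=
        Finset.sum_le_sum fun s' _ =>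
          mul_le_mul_of_nonneg_left (hf s') (G.p_mul_q_nonneg s s' a b)
    _ = d := by rw [← Finset.sum_mul, G.sum_p_mul_q, one_mul]

theorem le_sum_p_mul_q {f : X × Y → ℝ} {d : ℝ} (hf : ∀ s, d ≤ f s) (s : X × Y) (a : A)
    (b : B s.2) : d ≤ ∑ s' : X × Y, G.p s.1 a s'.1 * G.q s.2 b s'.2 * f s' := by
  have := G.sum_p_mul_q_le (f := fun s => - f s) (d := -d) (fun s => neg_le_neg (hf s)) s a b
  simp only [mul_neg, Finset.sum_neg_distrib] at this
  linarith

theorem oneShot_le {f : X × Y → ℝ} {d : ℝ} (hf : ∀ s, f s ≤ d) (s : X × Y) (a : A)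
    (b : B s.2) : G.oneShot f s a b ≤ 1 + d :=
  add_le_add (G.u_mem _ _ _ _).2 (G.sum_p_mul_q_le hf s a b)

theorem le_oneShot {f : X × Y → ℝ} {d : ℝ} (hf : ∀ s, d ≤ f s) (s : X × Y) (a : A)
    (b : B s.2) : d ≤ G.oneShot f s a b :=
  le_add_of_nonneg_of_le (G.u_mem _ _ _ _).1 (G.le_sum_p_mul_q hf s a b)

theorem oneShot_le_add {f f' : X × Y → ℝ} {d : ℝ} (hf : ∀ s, f s ≤ f' s + d) (s : X × Y) (a : A)
    (b : B s.2) : G.oneShot f s a b ≤ G.oneShot f' s a b + d := by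
  have := G.sum_p_mul_q_le (f := fun s => f s - f' s) (d := d)
    (fun s => by linarith [hf s]) s a b
  simp only [mul_sub, Finset.sum_sub_distrib] at this
  unfold oneShot
  linarith

theorem isOneShotPayoff (f : X × Y → ℝ) (s : X × Y) : IsOneShotPayoff (G.oneShot f s) where
  left b := (G.u_continuous_left _ _ _).add <| continuous_finsetSum _ fun s' _ =>
    ((G.p_continuous _ _).mul continuous_const).mul continuous_const
  right a := (G.u_continuous_right _ _ _).add <| continuous_finsetSum _ fun s' _ =>
    (continuous_const.mul (G.q_continuous _ _)).mul continuous_const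
  bounded := by
    obtain ⟨D, hD⟩ := (Set.finite_range fun s => |f s|).bddAbove
    have h : ∀ s, |f s| ≤ D := fun s => hD ⟨s, rfl⟩
    refine ⟨1 + D, fun a b => abs_le.2 ⟨?_, ?_⟩⟩
    · exact le_trans (by linarith) (G.le_oneShot (fun s => (abs_le.1 (h s)).1) s a b)
    · exact G.oneShot_le (fun s => (abs_le.1 (h s)).2) s a b

variable [MeasurableSpace A] [∀ y, MeasurableSpace (B y)]

/-- The Shapley operator. -/
noncomputable def shapley (f : X × Y → ℝ) (s : X × Y) : ℝ := mixedValue (G.oneShot f s)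

section StationaryStrategies

variable [MeasurableSpace X] [MeasurableSpace Y]

/-- The stationary strategy of player 1 playing `μ s` in state `s`. -/
noncomputable def stationary₁ (μ : X × Y → ProbabilityMeasure A) : G.Strategy₁ where
  act _ s := Kernel.const _ (μ s : Measure A)
  isMarkov _ _ := inferInstance

/-- The stationary strategy of player 2 playing `ν s` in state `s`. -/
noncomputable def stationary₂ (ν : (s : X × Y) → ProbabilityMeasure (B s.2)) : G.Strategy₂ where
  act _ s := Kernel.const _ (ν s : Measure (B s.2))
  isMarkov _ _ := inferInstance

theorem isMarkovPeriodic_stationary₁ (μ : X × Y → ProbabilityMeasure A) :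
    (G.stationary₁ μ).IsMarkovPeriodic 1 := ⟨fun _ => μ, fun _ _ _ => rfl⟩

theorem isMarkovPeriodic_stationary₂ (ν : (s : X × Y) → ProbabilityMeasure (B s.2)) :
    (G.stationary₂ ν).IsMarkovPeriodic 1 := ⟨fun _ => ν, fun _ _ _ => rfl⟩

end StationaryStrategies

variable [CompactSpace A] [Nonempty A] [BorelSpace A] [∀ y, Nonempty (B y)]

theorem shapley_le_add {f f' : X × Y → ℝ} {d : ℝ} (hf : ∀ s, f s ≤ f' s + d) (s : X × Y) :
    G.shapley f s ≤ G.shapley f' s + d :=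
  (G.isOneShotPayoff f s).mixedValue_le_add (G.isOneShotPayoff f' s) (G.oneShot_le_add hf s)

theorem shapley_le {f : X × Y → ℝ} {d : ℝ} (hf : ∀ s, f s ≤ d) (s : X × Y) :
    G.shapley f s ≤ 1 + d := by
  refine csSup_le (G.isOneShotPayoff f s).set_nonempty ?_
  rintro t ⟨μ, ht⟩
  obtain ⟨b⟩ := ‹∀ y, Nonempty (B y)› s.2
  exact (ht b).trans (((G.isOneShotPayoff f s).left b).integral_le_of_forall_le
    (fun a => G.oneShot_le hf s a b) _)

theorem le_shapley {f : X × Y → ℝ} {d : ℝ} (hf : ∀ s, d ≤ f s) (s : X × Y) :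
    d ≤ G.shapley f s := by
  obtain ⟨a⟩ := ‹Nonempty A›
  refine le_csSup (G.isOneShotPayoff f s).bddAbove
    ⟨⟨Measure.dirac a, inferInstance⟩, fun b => ?_⟩
  change _ ≤ ∫ a, G.oneShot f s a b ∂(Measure.dirac a)
  rw [integral_dirac' _ _ ((G.isOneShotPayoff f s).left b).measurable.stronglyMeasurable]
  exact G.le_oneShot hf s a b

/-- The (unnormalized) value of the discounted game exists, is nonnegative, and is at most the
inverse of the discount factor. -/
theorem exists_discounted_value [Nonempty X] [Nonempty Y] {l : ℝ} (h0 : 0 < l) (h1 : l < 1) :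
    ∃ V : X × Y → ℝ, (∀ s, V s = G.shapley (fun s' => (1 - l) * V s') s) ∧
      ∀ s, 0 ≤ V s ∧ l * V s ≤ 1 := by
  set T : (X × Y → ℝ) → X × Y → ℝ := fun V s => G.shapley (fun s' => (1 - l) * V s') s with hT
  have hT' : ∀ V W s, T V s ≤ T W s + (1 - l) * dist V W := fun V W s => by
    refine G.shapley_le_add (fun s' => ?_) s
    have := (le_abs_self _).trans ((Real.dist_eq _ _).symm.le.trans (dist_le_pi_dist V W s'))
    nlinarith
  have hc : ContractingWith (Real.toNNReal (1 - l)) T := by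
    refine ⟨by rw [Real.toNNReal_lt_one]; linarith, LipschitzWith.of_dist_le_mul fun V W => ?_⟩
    rw [Real.coe_toNNReal _ (by linarith)]
    refine (dist_pi_le_iff (mul_nonneg (by linarith) dist_nonneg)).2 fun s => ?_
    rw [Real.dist_eq, abs_le]
    have h₁ := hT' V W s
    have h₂ := hT' W V s
    rw [dist_comm W V] at h₂
    constructor <;> linarith
  have hV : ∀ s, hc.fixedPoint T s = G.shapley (fun s' => (1 - l) * hc.fixedPoint T s') s :=
    fun s => (congrFun hc.fixedPoint_isFixedPt s).symm
  generalize hc.fixedPoint T = V at hV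
  refine ⟨V, hV, ?_⟩
  obtain ⟨m, hm⟩ := Finite.exists_min V
  obtain ⟨M, hM⟩ := Finite.exists_max V
  -- Evaluating the fixed-point equation at a minimizer gives `0 ≤ V`; at a maximizer it gives `l *
  -- V ≤ 1`.
  have h₁ : (1 - l) * V m ≤ V m := by
    conv_rhs => rw [hV]
    exact G.le_shapley (fun s => mul_le_mul_of_nonneg_left (hm s) (by linarith)) m
  have h₂ : V M ≤ 1 + (1 - l) * V M := by
    conv_lhs => rw [hV]
    exact G.shapley_le (fun s => mul_le_mul_of_nonneg_left (hM s) (by linarith)) M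
  have h₃ : 0 ≤ V m := by nlinarith
  exact fun s => ⟨h₃.trans (hm s), by nlinarith [hM s]⟩

/-! ### From potentials to uniformly good stationary strategies. -/

section Strategies

variable [MeasurableSpace X] [MeasurableSpace Y]

variable [∀ y, BorelSpace (B y)]

theorem isTransition_trans : IsTransition G.trans where
  nonneg s k s' := G.p_mul_q_nonneg s s' k.1 k.2
  sum_eq_one s k := G.sum_p_mul_q s k.1 k.2
  measurable _ _ := ((G.p_continuous _ _).measurable.comp measurable_fst).mul
    ((G.q_continuous _ _).measurable.comp measurable_snd)

variable [DiscreteMeasurableSpace X] [DiscreteMeasurableSpace Y]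
  [TopologicalSpace.MetrizableSpace A] [SecondCountableTopology A]

theorem measurable_u (s : X × Y) : Measurable fun k : A × B s.2 => G.u s.1 s.2 k.1 k.2 :=
  measurable_uncurry_of_continuous_of_measurable (G.u_continuous_left s.1 s.2)
    fun a => (G.u_continuous_right s.1 s.2 a).measurable

theorem add_le_sum_expectedPayoff (σ : G.Strategy₁) (τ : G.Strategy₂) (φ : X × Y → ℝ) {c : ℝ}
    (h : ∀ n (h : (Fin n → Σ s : X × Y, A × B s.2) × (X × Y)), c + φ h.2 ≤
      ∫ k, G.oneShot φ h.2 k.1 k.2 ∂((σ.prod τ).act n h.2 h.1)) (s : X × Y) (N : ℕ) :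
    N * c + φ s ≤ ∑ n ∈ Finset.range N, G.expectedPayoff σ τ s n +
      ∫ h, φ h.2 ∂(historyLaw G.trans (σ.prod τ) s N) :=
  add_le_sum_of_potential G.isTransition_trans (σ.prod τ) s
    (U := fun s k => G.u s.1 s.2 k.1 k.2) G.measurable_u (C := 1)
    (fun s k => abs_le.2 ⟨by linarith [(G.u_mem s.1 s.2 k.1 k.2).1], (G.u_mem _ _ _ _).2⟩)
    φ h N

theorem sum_expectedPayoff_le (σ : G.Strategy₁) (τ : G.Strategy₂) (φ : X × Y → ℝ) {c : ℝ}
    (h : ∀ n (h : (Fin n → Σ s : X × Y, A × B s.2) × (X × Y)),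
      ∫ k, G.oneShot φ h.2 k.1 k.2 ∂((σ.prod τ).act n h.2 h.1) ≤ c + φ h.2)
    (s : X × Y) (N : ℕ) :
    ∑ n ∈ Finset.range N, G.expectedPayoff σ τ s n +
      ∫ h, φ h.2 ∂(historyLaw G.trans (σ.prod τ) s N) ≤ N * c + φ s := by
  -- The lower bound applied to the negated payoff, potential and rate.
  have := add_le_sum_of_potential G.isTransition_trans (σ.prod τ) s
    (U := fun s k => - G.u s.1 s.2 k.1 k.2) (fun s => (G.measurable_u s).neg) (C := 1)
    (fun s k => by
      rw [abs_neg]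
      exact abs_le.2 ⟨by linarith [(G.u_mem s.1 s.2 k.1 k.2).1], (G.u_mem _ _ _ _).2⟩)
    (fun s => - φ s) (c := -c) (fun n h' => by
      have := neg_le_neg (h n h')
      rw [← integral_neg] at this
      refine le_trans (by linarith) (this.trans_eq ?_)
      refine integral_congr_ae (Filter.Eventually.of_forall fun k => ?_)
      simp only [oneShot, trans, mul_neg, Finset.sum_neg_distrib]
      ring) N
  simp only [integral_neg, Finset.sum_neg_distrib] at this
  unfold expectedPayoff
  linarith

theorem exists_abs_integral_state_le (φ : X × Y → ℝ) : ∃ D, 0 ≤ D ∧ (∀ s, |φ s| ≤ D) ∧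
    ∀ (σ : G.Strategy₁) (τ : G.Strategy₂) (s : X × Y) (N : ℕ),
      |∫ h, φ h.2 ∂(historyLaw G.trans (σ.prod τ) s N)| ≤ D := by
  obtain ⟨D, hD⟩ := (Set.finite_range fun s => |φ s|).bddAbove
  have hD' : ∀ s, |φ s| ≤ max D 0 := fun s => (hD ⟨s, rfl⟩).trans (le_max_left _ _)
  refine ⟨max D 0, le_max_right _ _, hD', fun σ τ s N => ?_⟩
  have := isProbabilityMeasure_historyLaw G.isTransition_trans (σ.prod τ) s N
  refine (norm_integral_le_of_norm_le_const (C := max D 0)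
    (f := fun h : (Fin N → Σ s : X × Y, A × B s.2) × (X × Y) => φ h.2) (Filter.Eventually.of_forall fun h => hD' h.2)).trans ?_
  simp

theorem integrable_oneShot (φ : X × Y → ℝ) (s : X × Y) (ρ : Measure (A × B s.2))
    [IsFiniteMeasure ρ] : Integrable (fun k => G.oneShot φ s k.1 k.2) ρ :=
  (G.isOneShotPayoff φ s).integrable_uncurry ρ

/-- The potential at the two ends costs at most `2 * D` in total, which the gap `c - (v - ε)`,
multiplied by a large `N`, absorbs. -/
theorem isOptimal₁_stationary₁ (φ : X × Y → ℝ) {c v ε : ℝ} (hcv : v - ε < c)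
    (μ : X × Y → ProbabilityMeasure A)
    (h : ∀ s b, c + φ s ≤ ∫ a, G.oneShot φ s a b ∂(μ s : Measure A)) (s : X × Y) :
    G.IsOptimal₁ ε v s (G.stationary₁ μ) := by
  obtain ⟨D, hD0, hD, hDi⟩ := G.exists_abs_integral_state_le φ
  obtain ⟨M, hM⟩ := exists_nat_gt (2 * D / (c - (v - ε)))
  refine ⟨M + 1, by omega, fun τ N hN => ?_⟩
  have hN' : (0 : ℝ) < N := by exact_mod_cast (by omega : 0 < N)
  have key := G.add_le_sum_expectedPayoff (G.stationary₁ μ) τ φ (c := c) (fun n h' => by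
    have := τ.isMarkov n h'.2
    have := (G.stationary₁ μ).isMarkov n h'.2
    have e : ((G.stationary₁ μ).prod τ).act n h'.2 h'.1 =
      (μ h'.2 : Measure A).prod (τ.act n h'.2 h'.1) := Kernel.prod_apply _ _ _
    -- Player 2's action is put in the outer integral, so that `h` applies to each of his pure
    -- actions.
    rw [e, integral_prod_symm _ (G.integrable_oneShot φ h'.2 _)]
    have := integral_mono (integrable_const _)
      ((G.integrable_oneShot φ h'.2
        ((μ h'.2 : Measure A).prod (τ.act n h'.2 h'.1))).integral_prod_right) (h h'.2)
    simpa using this) s N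
  have h₁ := (abs_le.1 (hDi (G.stationary₁ μ) τ s N)).2
  have h₂ := (abs_le.1 (hD s)).1
  have h₃ : 2 * D < N * (c - (v - ε)) := by
    rw [div_lt_iff₀ (by linarith)] at hM
    have : (M : ℝ) ≤ N := by exact_mod_cast (by omega : M ≤ N)
    nlinarith
  rw [payoff, one_div, le_inv_mul_iff₀ hN']
  linarith

theorem isOptimal₂_stationary₂ (φ : X × Y → ℝ) {c v ε : ℝ} (hcv : c < v + ε)
    (ν : (s : X × Y) → ProbabilityMeasure (B s.2))
    (h : ∀ s a, ∫ b, G.oneShot φ s a b ∂(ν s : Measure (B s.2)) ≤ c + φ s) (s : X × Y) :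
    G.IsOptimal₂ ε v s (G.stationary₂ ν) := by
  obtain ⟨D, hD0, hD, hDi⟩ := G.exists_abs_integral_state_le φ
  obtain ⟨M, hM⟩ := exists_nat_gt (2 * D / (v + ε - c))
  refine ⟨M + 1, by omega, fun σ N hN => ?_⟩
  have hN' : (0 : ℝ) < N := by exact_mod_cast (by omega : 0 < N)
  have key := G.sum_expectedPayoff_le σ (G.stationary₂ ν) φ (c := c) (fun n h' => by
    have := σ.isMarkov n h'.2
    have := (G.stationary₂ ν).isMarkov n h'.2
    have e : (σ.prod (G.stationary₂ ν)).act n h'.2 h'.1 =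
      (σ.act n h'.2 h'.1).prod (ν h'.2 : Measure (B h'.2.2)) := Kernel.prod_apply _ _ _
    rw [e, integral_prod _ (G.integrable_oneShot φ h'.2 _)]
    have := integral_mono ((G.integrable_oneShot φ h'.2
        ((σ.act n h'.2 h'.1).prod (ν h'.2 : Measure (B h'.2.2)))).integral_prod_left)
      (integrable_const _) (h h'.2)
    simpa using this) s N
  have h₁ := (abs_le.1 (hDi σ (G.stationary₂ ν) s N)).1
  have h₂ := (abs_le.1 (hD s)).2
  have h₃ : 2 * D < N * (v + ε - c) := by
    rw [div_lt_iff₀ (by linarith)] at hM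
    have : (M : ℝ) ≤ N := by exact_mod_cast (by omega : M ≤ N)
    nlinarith
  rw [payoff, one_div, inv_mul_le_iff₀ hN']
  linarith

/-- Undiscounting the continuation adds the expectation of `l * V` at the next state; bounds on `l *
V` thus become the per-stage rate. -/
theorem oneShot_eq_discounted_add (V : X × Y → ℝ) (l : ℝ) (s : X × Y) (a : A) (b : B s.2) :
    G.oneShot V s a b = G.oneShot (fun s' => (1 - l) * V s') s a b +
      ∑ s' : X × Y, G.p s.1 a s'.1 * G.q s.2 b s'.2 * (l * V s') := by
  unfold oneShot
  rw [add_assoc, ← Finset.sum_add_distrib]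
  congr 1
  exact Finset.sum_congr rfl fun s' _ => by ring

/-- In terms of a discounted value `V`, player 1 uniformly guarantees `min l * V` up to `ε` with a
stationary strategy. -/
theorem exists_stationary₁ {V : X × Y → ℝ} {l : ℝ}
    (hV : ∀ s, V s = G.shapley (fun s' => (1 - l) * V s') s) {m v ε : ℝ} (hm : ∀ s, m ≤ l * V s)
    (hv : v - ε < m) :
    ∃ μ : X × Y → ProbabilityMeasure A, ∀ s, G.IsOptimal₁ ε v s (G.stationary₁ μ) := by
  have hδ : 0 < (m - (v - ε)) / 2 := by linarith
  choose μ hμ using fun s =>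
    (G.isOneShotPayoff (fun s' => (1 - l) * V s') s).exists_guarantee_left hδ
  -- Half of the gap pays for the merely approximate one-shot optimality of `μ`; the other half is
  -- the strict margin on the rate.
  refine ⟨μ, G.isOptimal₁_stationary₁ V (c := m - (m - (v - ε)) / 2) (by linarith) μ
    fun s b => ?_⟩
  have hi := ((G.isOneShotPayoff (fun s' => (1 - l) * V s') s).left b).integrable_of_compactSpace
    (μ s : Measure A)
  have h₁ := integral_mono (hi.add (integrable_const m))
    (((G.isOneShotPayoff V s).left b).integrable_of_compactSpace (μ s : Measure A)) (fun a => by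
      rw [G.oneShot_eq_discounted_add V l]
      exact add_le_add le_rfl (G.le_sum_p_mul_q hm s a b))
  rw [Pi.add_def, integral_add hi (integrable_const m)] at h₁
  simp only [integral_const, probReal_univ, one_smul] at h₁
  have h₂ := hμ s b
  change G.shapley _ s - _ ≤ _ at h₂
  rw [← hV] at h₂
  linarith

/-- In terms of a discounted value `V`, player 2 uniformly guarantees `max l * V` up to `ε` with a
stationary strategy. -/
theorem exists_stationary₂ [∀ y, CompactSpace (B y)] [∀ y, T2Space (B y)] {V : X × Y → ℝ} {l : ℝ}
    (hV : ∀ s, V s = G.shapley (fun s' => (1 - l) * V s') s) {m v ε : ℝ} (hm : ∀ s, l * V s ≤ m)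
    (hv : m < v + ε) :
    ∃ ν : (s : X × Y) → ProbabilityMeasure (B s.2),
      ∀ s, G.IsOptimal₂ ε v s (G.stationary₂ ν) := by
  choose ν hν using fun s =>
    (G.isOneShotPayoff (fun s' => (1 - l) * V s') s).exists_guarantee_right
  refine ⟨ν, G.isOptimal₂_stationary₂ V hv ν fun s a => ?_⟩
  have hi := ((G.isOneShotPayoff (fun s' => (1 - l) * V s') s).right a).integrable_of_compactSpace
    (ν s : Measure (B s.2))
  have h₁ := integral_mono
    (((G.isOneShotPayoff V s).right a).integrable_of_compactSpace (ν s : Measure (B s.2)))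
    (hi.add (integrable_const m)) (fun b => by
      rw [G.oneShot_eq_discounted_add V l]
      exact add_le_add le_rfl (G.sum_p_mul_q_le hm s a b))
  rw [Pi.add_def, integral_add hi (integrable_const m)] at h₁
  simp only [integral_const, probReal_univ, one_smul] at h₁
  have h₂ := hν s a
  change _ ≤ G.shapley _ s at h₂
  rw [← hV] at h₂
  linarith

/-- If the oscillation of the discounted values is bounded independently of the discount factor,
then the game has a uniform value which does not depend on the initial state, and the players have
stationary `ε`-optimal strategies. -/
theorem exists_uniform_value [Nonempty X] [Nonempty Y] [∀ y, CompactSpace (B y)]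
    [∀ y, T2Space (B y)] {D : ℝ} (hD : ∀ (l : ℝ) (V : X × Y → ℝ), 0 < l → l < 1 →
      (∀ s, 0 ≤ V s) → (∀ s, V s = G.shapley (fun s' => (1 - l) * V s') s) →
      ∀ s s', V s ≤ V s' + D) :
    ∃ v ∈ Set.Icc (0 : ℝ) 1, ∀ ε : ℝ, 0 < ε →
      (∃ μ : X × Y → ProbabilityMeasure A, ∀ s, G.IsOptimal₁ ε v s (G.stationary₁ μ)) ∧
      ∃ ν : (s : X × Y) → ProbabilityMeasure (B s.2),
        ∀ s, G.IsOptimal₂ ε v s (G.stationary₂ ν) := by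
  have hl0 : ∀ n : ℕ, (0 : ℝ) < 1 / ((n : ℝ) + 2) := fun n => by positivity
  have hl1 : ∀ n : ℕ, 1 / ((n : ℝ) + 2) < 1 := fun n => by
    rw [div_lt_one (by positivity)]
    have : (0 : ℝ) ≤ n := n.cast_nonneg
    linarith
  choose V hV hV01 using fun n => G.exists_discounted_value (hl0 n) (hl1 n)
  obtain ⟨s₀⟩ := (inferInstance : Nonempty (X × Y))
  -- The candidate value is any cluster point of the normalized discounted values; since the same
  -- `v` is guaranteed by both players, convergence of the whole sequence is not needed.
  obtain ⟨v, hv, θ, hθ, hlim⟩ := isCompact_Icc.tendsto_subseq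
    (x := fun n : ℕ => 1 / ((n : ℝ) + 2) * V n s₀) (s := Set.Icc (0 : ℝ) 1)
    (fun n => ⟨mul_nonneg (hl0 n).le (hV01 n s₀).1, (hV01 n s₀).2⟩)
  refine ⟨v, hv, fun ε hε => ?_⟩
  have h₁ : Filter.Tendsto (fun n : ℕ => 1 / ((n : ℝ) + 2) * D) Filter.atTop (nhds 0) := by
    have := (tendsto_const_nhds (x := (1 : ℝ))).div_atTop
      (Filter.tendsto_atTop_add_const_right _ (2 : ℝ) tendsto_natCast_atTop_atTop)
    simpa using this.mul_const D
  have h₂ := (h₁.comp hθ.tendsto_atTop).eventually_lt_const (half_pos hε)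
  have h₃ := hlim.eventually (Metric.ball_mem_nhds v (half_pos hε))
  obtain ⟨n, hn₂, hn₃⟩ := (h₂.and h₃).exists
  simp only [Function.comp_apply, Real.dist_eq, abs_lt] at hn₂ hn₃
  set l : ℝ := 1 / ((θ n : ℕ) + 2 : ℝ) with hl
  have hosc := hD l (V (θ n)) (hl0 _) (hl1 _) (fun s => (hV01 _ s).1) (hV _)
  constructor
  · refine G.exists_stationary₁ (hV (θ n)) (m := l * V (θ n) s₀ - l * D) (fun s => ?_)
      (by linarith)
    have := mul_le_mul_of_nonneg_left (hosc s₀ s) (hl0 (θ n)).le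
    rw [← hl] at this ⊢
    linarith
  · refine G.exists_stationary₂ (hV (θ n)) (m := l * V (θ n) s₀ + l * D) (fun s => ?_)
      (by linarith)
    have := mul_le_mul_of_nonneg_left (hosc s s₀) (hl0 (θ n)).le
    rw [← hl] at this ⊢
    linarith

end Strategies

/-! ### Bounded oscillation from reachability. -/

section Oscillation

variable [TopologicalSpace.MetrizableSpace A] [SecondCountableTopology A]
  [∀ y, BorelSpace (B y)]

/-- If player 2 can make sure that the state `t` is reached in `k` stages from `s` with probability
at least `ρ k s`, the value at `s` cannot exceed the value at `t` by much. -/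
theorem le_of_reach {V : X × Y → ℝ} {l : ℝ} (h0 : 0 < l) (hV0 : ∀ s, 0 ≤ V s)
    (hV : ∀ s, V s = G.shapley (fun s' => (1 - l) * V s') s) {M : ℝ} (hM : ∀ s, V s ≤ M)
    {t : X × Y} {ρ : ℕ → X × Y → ℝ} (hρ0 : ∀ s, s ≠ t → ρ 0 s ≤ 0) (hρt : ρ 0 t ≤ 1)
    (hρ : ∀ k s, ∃ ν : ProbabilityMeasure (B s.2), ∀ a, ρ (k + 1) s ≤
      ∫ b, ∑ s' : X × Y, G.p s.1 a s'.1 * G.q s.2 b s'.2 * ρ k s' ∂(ν : Measure (B s.2)))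
    [∀ y, CompactSpace (B y)] (k : ℕ) (s : X × Y) :
    V s ≤ k + M - ρ k s * (M - V t) := by
  have hD : 0 ≤ M - V t := sub_nonneg.2 (hM t)
  induction k generalizing s with
  | zero =>
    by_cases hs : s = t
    · subst hs
      have := mul_le_mul_of_nonneg_right hρt hD
      push_cast
      linarith
    · have := mul_nonneg (neg_nonneg.2 (hρ0 s hs)) hD
      push_cast
      linarith [hM s]
  | succ k ih =>
    obtain ⟨ν, hν⟩ := hρ k s
    rw [hV s]
    refine (G.isOneShotPayoff _ s).mixedValue_le (ν : Measure (B s.2)) fun a => ?_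
    have hc : Continuous fun b => ∑ s' : X × Y, G.p s.1 a s'.1 * G.q s.2 b s'.2 * ρ k s' :=
      continuous_finsetSum _ fun s' _ =>
        (continuous_const.mul (G.q_continuous _ _)).mul continuous_const
    have hi := hc.integrable_of_compactSpace (ν : Measure (B s.2))
    have h₁ := integral_mono
      (((G.isOneShotPayoff (fun s' => (1 - l) * V s') s).right a).integrable_of_compactSpace
        (ν : Measure (B s.2)))
      ((integrable_const (1 + k + M)).sub (hi.mul_const (M - V t))) (fun b => by
        -- Dropping the factor `1 - l` only increases the bound because `0 ≤ V`, and the stage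
        -- payoff adds at most 1, turning `k` into `k + 1`.
        have e₁ : G.oneShot (fun s' => (1 - l) * V s') s a b ≤
            1 + ∑ s' : X × Y, G.p s.1 a s'.1 * G.q s.2 b s'.2 *
              (k + M - ρ k s' * (M - V t)) := by
          refine add_le_add (G.u_mem _ _ _ _).2 (Finset.sum_le_sum fun s' _ => ?_)
          refine mul_le_mul_of_nonneg_left ?_ (G.p_mul_q_nonneg s s' a b)
          have := mul_nonneg h0.le (hV0 s')
          linarith [ih s']
        refine e₁.trans_eq ?_
        simp only [mul_sub, Finset.sum_sub_distrib, ← Finset.sum_mul, G.sum_p_mul_q, Pi.sub_apply,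
          ← mul_assoc]
        ring)
    rw [integral_sub' (integrable_const _) (hi.mul_const _), integral_mul_const] at h₁
    simp only [integral_const, probReal_univ, one_smul] at h₁
    have h₂ := mul_le_mul_of_nonneg_right (hν a) hD
    push_cast
    linarith

/-- If from every state player 2 can reach every state with positive probability, the oscillation
of the discounted values is bounded. -/
theorem exists_oscillation_bound [∀ y, CompactSpace (B y)]
    (h : ∀ t : X × Y, ∃ ρ : ℕ → X × Y → ℝ, (∀ s, s ≠ t → ρ 0 s ≤ 0) ∧ ρ 0 t ≤ 1 ∧
      (∀ k s, ∃ ν : ProbabilityMeasure (B s.2), ∀ a, ρ (k + 1) s ≤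
        ∫ b, ∑ s' : X × Y, G.p s.1 a s'.1 * G.q s.2 b s'.2 * ρ k s' ∂(ν : Measure (B s.2))) ∧
      ∀ s, ∃ k, 0 < ρ k s) :
    ∃ D : ℝ, ∀ (l : ℝ) (V : X × Y → ℝ), 0 < l → l < 1 → (∀ s, 0 ≤ V s) →
      (∀ s, V s = G.shapley (fun s' => (1 - l) * V s') s) → ∀ s s', V s ≤ V s' + D := by
  choose ρ hρ0 hρt hρ hpos using h
  choose k hk using hpos
  obtain ⟨D, hD⟩ := (Set.finite_range
    fun z : (X × Y) × (X × Y) => (k z.1 z.2 : ℝ) / ρ z.1 (k z.1 z.2) z.2).bddAbove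
  refine ⟨D, fun l V h0 _ hV0 hV s t => ?_⟩
  have : Nonempty (X × Y) := ⟨s⟩
  obtain ⟨m, hm⟩ := Finite.exists_max V
  -- Starting from a maximizer, `V m` cancels and leaves `ρ * (V m - V t) ≤ k`, a bound free of `l`.
  have h₁ := G.le_of_reach h0 hV0 hV hm (hρ0 t) (hρt t) (hρ t) (k t m) m
  have h₂ : V m - V t ≤ (k t m : ℝ) / ρ t (k t m) m := by
    rw [le_div_iff₀ (hk t m)]
    linarith
  have h₃ : (k t m : ℝ) / ρ t (k t m) m ≤ D := hD ⟨(t, m), rfl⟩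
  linarith [hm s]

end Oscillation

end ProductGame

end Stationary

/-! ### Worst-case reaching probabilities for player 1. -/

section Reach

variable {X A : Type*} [Fintype X] [TopologicalSpace A]

open Classical in
/-- The smallest probability, over the behaviour of the player, that the state is `t` after `k`
transitions. -/
noncomputable def minReach (p : X → A → X → ℝ) (t : X) : ℕ → X → ℝ
  | 0, x => if x = t then 1 else 0
  | k + 1, x => ⨅ a, ∑ x', p x a x' * minReach p t k x'

variable {p : X → A → X → ℝ} (t : X)

/-- Attainment by compactness is essential: it lets positivity for each policy pass to the infimum.
-/
theorem exists_minReach_succ_eq [CompactSpace A] [Nonempty A]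
    (hp : ∀ x x', Continuous fun a => p x a x') (k : ℕ) (x : X) :
    ∃ a, minReach p t (k + 1) x = ∑ x', p x a x' * minReach p t k x' ∧
      ∀ a', minReach p t (k + 1) x ≤ ∑ x', p x a' x' * minReach p t k x' := by
  have hc : Continuous fun a => ∑ x', p x a x' * minReach p t k x' :=
    continuous_finsetSum _ fun x' _ => (hp x x').mul continuous_const
  obtain ⟨a, -, ha⟩ := isCompact_univ.exists_isMinOn Set.univ_nonempty hc.continuousOn
  have ha' : ∀ a', ∑ x', p x a x' * minReach p t k x' ≤ ∑ x', p x a' x' * minReach p t k x' :=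
    fun a' => ha (Set.mem_univ a')
  have e : minReach p t (k + 1) x = ∑ x', p x a x' * minReach p t k x' :=
    le_antisymm (ciInf_le ⟨_, by rintro _ ⟨a', rfl⟩; exact ha' a'⟩ a) (le_ciInf ha')
  exact ⟨a, e, fun a' => e.trans_le (ha' a')⟩

end Reach

/-! ### Reachability in the game restricted to a recurrent class. -/

section Restrict

set_option linter.unusedSectionVars false

namespace ProductGame

section Player₁

variable {X Y A : Type*} {B : Y → Type*} [Fintype X] [Fintype Y]
  [TopologicalSpace A] [∀ y, TopologicalSpace (B y)] [CompactSpace A] [Nonempty A]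
  (G : ProductGame X Y A B) (t : X)

theorem minReach_succ_pos {k : ℕ} (hk : ∀ x, 0 < minReach G.p t k x) (x : X) :
    0 < minReach G.p t (k + 1) x := by
  obtain ⟨a, ha, -⟩ := exists_minReach_succ_eq t G.p_continuous k x
  rw [ha]
  refine lt_of_le_of_ne
    (Finset.sum_nonneg fun x' _ => mul_nonneg (G.p_nonneg x a x') (hk x').le) fun h => ?_
  rw [eq_comm, Finset.sum_eq_zero_iff_of_nonneg
    fun x' _ => mul_nonneg (G.p_nonneg x a x') (hk x').le] at h
  have : ∑ x', G.p x a x' = 0 := Finset.sum_eq_zero fun x' hx' =>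
    (mul_eq_zero.1 (h x' hx')).resolve_right (hk x').ne'
  rw [G.p_sum] at this
  exact one_ne_zero this

variable [MeasurableSpace X] [DiscreteMeasurableSpace X] [MeasurableSpace A] [BorelSpace A]

theorem isTransition_p : IsTransition (K := fun _ : X => A) G.p where
  nonneg := G.p_nonneg
  sum_eq_one := G.p_sum
  measurable x x' := (G.p_continuous x x').measurable

/-- The minimal probability of reaching `t` in `T` transitions is realized by a behaviour rule. -/
theorem exists_behavior_minReach (T : ℕ) (x : X) :
    ∃ σ : Behavior X (fun _ => A) (fun _ => A),
      (historyLaw G.p σ x T).real {h | h.2 = t} = minReach G.p t T x := by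
  choose a ha _ using exists_minReach_succ_eq (p := G.p) t G.p_continuous
  let σ : Behavior X (fun _ => A) (fun _ => A) :=
    -- At stage `n` the chosen action minimizes the probability with `T - (n + 1)` transitions left
    -- after it; the expectation in `key` is then constant in `n`.
    { act := fun n x => Kernel.const _ (Measure.dirac (a (T - (n + 1)) x))
      isMarkov := fun _ _ => inferInstance }
  refine ⟨σ, ?_⟩
  have key : ∀ n ≤ T,
      ∫ h, minReach G.p t (T - n) h.2 ∂(historyLaw G.p σ x n) = minReach G.p t T x := by
    intro n
    induction n with
    | zero =>
      intro _
      exact integral_dirac' _ _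
        ((measurable_of_countable (minReach G.p t T)).comp measurable_snd).stronglyMeasurable
    | succ n ih =>
      intro hn
      rw [integral_historyLaw_succ G.isTransition_p, ← ih (by omega)]
      refine integral_congr_ae (Filter.Eventually.of_forall fun h => ?_)
      have hm : Measurable fun k => ∑ x', G.p h.2 k x' * minReach G.p t (T - (n + 1)) x' :=
        Finset.measurable_sum _ fun x' _ => (G.isTransition_p.measurable _ _).mul_const _
      change ∫ k, ∑ x', G.p h.2 k x' * minReach G.p t (T - (n + 1)) x'
        ∂(Measure.dirac (a (T - (n + 1)) h.2)) = minReach G.p t (T - n) h.2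
      rw [integral_dirac' _ _ hm.stronglyMeasurable, ← ha]
      congr 1
      omega
  have hs : MeasurableSet {h : (Fin T → Σ _ : X, A) × X | h.2 = t} :=
    measurable_snd (measurableSet_singleton t)
  have := key T le_rfl
  rw [← this, Nat.sub_self, ← integral_indicator_one hs]
  refine integral_congr_ae (Filter.Eventually.of_forall fun h => ?_)
  by_cases hh : h.2 = t <;> simp [minReach, Set.indicator, hh]

/-- The minimizing rule is itself a policy, so strong communication makes the minimum positive after
`T - 1` transitions. Averaging a positive function keeps it positive, hence all later times. -/
theorem StronglyCommunicating₁.exists_minReach_pos {G : ProductGame X Y A B}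
    (hG : G.StronglyCommunicating₁) :
    ∃ T : ℕ, ∀ t k x, T ≤ k → 0 < minReach G.p t k x := by
  obtain ⟨T, -, hT⟩ := hG
  refine ⟨T - 1, fun t k x hk => ?_⟩
  induction k, hk using Nat.le_induction generalizing x with
  | base =>
    obtain ⟨σ, hσ⟩ := G.exists_behavior_minReach t (T - 1) x
    have := isProbabilityMeasure_historyLaw G.isTransition_p σ x (T - 1)
    rw [← hσ]
    exact ENNReal.toReal_pos (hT σ x t).ne' (measure_ne_top _ _)
  | succ k _ ih => exact G.minReach_succ_pos t ih x

end Player₁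

/-! ### Player 2's chain on a recurrent class. -/

section Player₂

variable {X Y A : Type*} {B : Y → Type*} [Fintype X] [Fintype Y] [DecidableEq Y]
  [TopologicalSpace A] [∀ y, TopologicalSpace (B y)]
  [∀ y, CompactSpace (B y)] [∀ y, MeasurableSpace (B y)] [∀ y, BorelSpace (B y)]
  (G : ProductGame X Y A B) (ν : (y : Y) → ProbabilityMeasure (B y))

theorem integrable_q (y y' : Y) : Integrable (fun b => G.q y b y') (ν y : Measure (B y)) :=
  (G.q_continuous y y').integrable_of_compactSpace _

theorem chain_pow_nonneg (k : ℕ) (y y' : Y) : 0 ≤ (G.chain ν ^ k) y y' := by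
  induction k generalizing y with
  | zero => rw [pow_zero, Matrix.one_apply]; split_ifs <;> norm_num
  | succ k ih =>
    rw [pow_succ', Matrix.mul_apply]
    exact Finset.sum_nonneg fun z _ =>
      mul_nonneg (integral_nonneg fun b => G.q_nonneg y b z) (ih z)

theorem sum_chain_pow (k : ℕ) (y : Y) : ∑ y', (G.chain ν ^ k) y y' = 1 := by
  induction k generalizing y with
  | zero => simp [Matrix.one_apply]
  | succ k ih =>
    simp_rw [pow_succ', Matrix.mul_apply]
    rw [Finset.sum_comm]
    simp_rw [← Finset.mul_sum, ih, mul_one, chain]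
    rw [← integral_finsetSum _ fun z _ => G.integrable_q ν y z]
    simp [G.q_sum]

variable {G ν} {C : Finset Y}

theorem chain_eq_zero_of_isRecurrentClass (hC : IsRecurrentClass (G.chain ν) C) {y y' : Y}
    (hy : y ∈ C) (hy' : y' ∉ C) : G.chain ν y y' = 0 := by
  refine le_antisymm (not_lt.1 fun h => hy' ?_) (integral_nonneg fun b => G.q_nonneg y b y')
  exact (hC.2 y hy y').2 ⟨1, by rwa [pow_one]⟩

/-- Walk `T` steps to some state, which stays in the class, then go on to `y'`. Arbitrarily late
times are needed to match the threshold in `exists_minReach_pos`. -/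
theorem exists_le_chain_pow_pos (hC : IsRecurrentClass (G.chain ν) C) {y y' : Y} (hy : y ∈ C)
    (hy' : y' ∈ C) (T : ℕ) : ∃ k, T ≤ k ∧ 0 < (G.chain ν ^ k) y y' := by
  obtain ⟨z, -, hz⟩ : ∃ z ∈ Finset.univ, 0 < (G.chain ν ^ T) y z := by
    by_contra! h
    have := Finset.sum_nonpos h
    rw [G.sum_chain_pow ν] at this
    linarith
  obtain ⟨k, hk⟩ := (hC.2 z ((hC.2 y hy z).2 ⟨T, hz⟩) y').1 hy'
  refine ⟨T + k, by omega, ?_⟩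
  rw [pow_add, Matrix.mul_apply]
  exact (mul_pos hz hk).trans_le (Finset.single_le_sum (f := fun z =>
    (G.chain ν ^ T) y z * (G.chain ν ^ k) z y') (fun z _ =>
      mul_nonneg (G.chain_pow_nonneg ν T y z) (G.chain_pow_nonneg ν k z y')) (Finset.mem_univ z))

theorem measurableSet_stayAction (G : ProductGame X Y A B) (C : Finset Y) (y : Y) :
    MeasurableSet {b : B y | ∑ y' ∈ C, G.q y b y' = 1} :=
  (isClosed_eq (continuous_finsetSum _ fun y' _ => G.q_continuous y y')
    continuous_const).measurableSet

/-- The chain never leaves the class, and a nonnegative exit probability with zero mean vanishes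
almost surely. -/
theorem ae_stayAction (hC : IsRecurrentClass (G.chain ν) C) {y : Y} (hy : y ∈ C) :
    ∀ᵐ b ∂(ν y : Measure (B y)), ∑ y' ∈ C, G.q y b y' = 1 := by
  have h : ∀ y' ∉ C, ∀ᵐ b ∂(ν y : Measure (B y)), G.q y b y' = 0 := fun y' hy' =>
    (integral_eq_zero_iff_of_nonneg (fun b => G.q_nonneg y b y') (G.integrable_q ν y y')).1
      (chain_eq_zero_of_isRecurrentClass hC hy hy')
  have h' : ∀ᵐ b ∂(ν y : Measure (B y)), ∀ y', y' ∉ C → G.q y b y' = 0 :=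
    ae_all_iff.2 fun y' => by
      by_cases hy' : y' ∈ C
      · exact Filter.Eventually.of_forall fun b hb => absurd hy' hb
      · filter_upwards [h y' hy'] with b hb _ using hb
  filter_upwards [h'] with b hb
  rw [← G.q_sum y b]
  exact Finset.sum_subset (Finset.subset_univ C) fun y' _ hy' => hb y' hy'

/-- In a recurrent class, the stationary policy only uses actions which stay in the class. -/
theorem exists_stayAction_measure (hC : IsRecurrentClass (G.chain ν) C) (y : C) :
    ∃ ρ : ProbabilityMeasure (G.StayAction C y), ∀ f : B y → ℝ,
      ∫ b, f b.1 ∂(ρ : Measure (G.StayAction C y)) = ∫ b, f b ∂(ν y : Measure (B y)) := by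
  have hm := G.measurableSet_stayAction C y
  have hae : ∀ᵐ b ∂(ν y : Measure (B y)), b ∈ {b : B y | ∑ y' ∈ C, G.q y b y' = 1} :=
    ae_stayAction hC y.2
  refine ⟨⟨Measure.comap Subtype.val (ν y : Measure (B y)), ⟨?_⟩⟩, fun f => ?_⟩
  · refine ((MeasurableEmbedding.subtype_coe hm).comap_apply _ _).trans ?_
    rw [Set.image_univ, Subtype.range_coe]
    exact (prob_compl_eq_zero_iff hm).1 hae
  · refine (integral_subtype_comap hm f).trans ?_
    rw [Measure.restrict_eq_self_of_ae_mem hae]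

theorem nonempty_stayAction (hC : IsRecurrentClass (G.chain ν) C) (y : C) :
    Nonempty (G.StayAction C y) := by
  obtain ⟨b, hb⟩ := (ae_stayAction hC y.2).exists
  exact ⟨⟨b, hb⟩⟩

end Player₂

/-! ### Assembly. -/

section Main

variable {X Y A : Type*} {B : Y → Type*} [Fintype X] [Fintype Y] [DecidableEq Y]
  [MeasurableSpace X] [DiscreteMeasurableSpace X]
  [TopologicalSpace A] [CompactSpace A] [TopologicalSpace.MetrizableSpace A]
  [SecondCountableTopology A] [Nonempty A] [MeasurableSpace A] [BorelSpace A]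
  [∀ y, TopologicalSpace (B y)] [∀ y, CompactSpace (B y)] [∀ y, MeasurableSpace (B y)]
  [∀ y, BorelSpace (B y)] {G : ProductGame X Y A B}

instance compactSpace_stayAction (C : Finset Y) (y : C) : CompactSpace (G.StayAction C y) :=
  isCompact_iff_compactSpace.1 (isClosed_eq (continuous_finsetSum _ fun y' _ =>
    G.q_continuous y y') continuous_const).isCompact

/-- In the game restricted to a recurrent class, player 2 can reach every state from every state
with positive probability, whatever player 1 does. -/
theorem StronglyCommunicating₁.exists_reach (hG : G.StronglyCommunicating₁)
    {ν : (y : Y) → ProbabilityMeasure (B y)} {C : Finset Y}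
    (hC : IsRecurrentClass (G.chain ν) C) (t : X × C) :
    ∃ ρ : ℕ → X × C → ℝ, (∀ s, s ≠ t → ρ 0 s ≤ 0) ∧ ρ 0 t ≤ 1 ∧
      (∀ k s, ∃ ν' : ProbabilityMeasure (G.StayAction C s.2), ∀ a, ρ (k + 1) s ≤
        ∫ b, ∑ s' : X × C, (G.restrict C).p s.1 a s'.1 * (G.restrict C).q s.2 b s'.2 * ρ k s'
          ∂(ν' : Measure (G.StayAction C s.2))) ∧
      ∀ s, ∃ k, 0 < ρ k s := by
  obtain ⟨T, hT⟩ := hG.exists_minReach_pos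
  -- Player 2 follows `ν` whatever player 1 does; by independence of the transitions the one-step
  -- expectation factors as in `e`.
  refine ⟨fun k s => minReach G.p t.1 k s.1 * (G.chain ν ^ k) s.2 t.2, fun s hs => ?_, ?_,
    fun k s => ?_, fun s => ?_⟩
  · by_cases h₁ : s.1 = t.1
    · have h₂ : (s.2 : Y) ≠ t.2 := fun h => hs (Prod.ext h₁ (Subtype.ext h))
      simp [Matrix.one_apply_ne h₂]
    · simp [minReach, h₁]
  · simp [minReach]
  · obtain ⟨ν', hν'⟩ := exists_stayAction_measure hC s.2
    refine ⟨ν', fun a => ?_⟩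
    obtain ⟨-, -, ha⟩ := exists_minReach_succ_eq t.1 G.p_continuous k s.1
    have e : ∀ b : G.StayAction C s.2, ∑ s' : X × C, (G.restrict C).p s.1 a s'.1 *
        (G.restrict C).q s.2 b s'.2 * (minReach G.p t.1 k s'.1 * (G.chain ν ^ k) s'.2 t.2) =
        (∑ x, G.p s.1 a x * minReach G.p t.1 k x) *
          ∑ y ∈ C, G.q s.2 b.1 y * (G.chain ν ^ k) y t.2 := fun b => by
      rw [← Finset.sum_coe_sort C, Finset.sum_mul_sum, Fintype.sum_prod_type]
      exact Finset.sum_congr rfl fun x _ => Finset.sum_congr rfl fun y _ => by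
        simp only [restrict]; ring
    simp_rw [e]
    rw [hν' fun b => (∑ x, G.p s.1 a x * minReach G.p t.1 k x) *
      ∑ y ∈ C, G.q s.2 b y * (G.chain ν ^ k) y t.2, integral_const_mul,
      integral_finsetSum _ fun y _ => (G.integrable_q ν s.2 y).mul_const _]
    simp_rw [integral_mul_const]
    have e' : (G.chain ν ^ (k + 1)) s.2 t.2 =
        ∑ y ∈ C, (∫ b, G.q s.2 b y ∂(ν s.2 : Measure (B s.2))) * (G.chain ν ^ k) y t.2 := by
      rw [pow_succ', Matrix.mul_apply]
      refine (Finset.sum_subset (Finset.subset_univ C) fun y _ hy => ?_).symm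
      change G.chain ν s.2 y * _ = 0
      rw [chain_eq_zero_of_isRecurrentClass hC s.2.2 hy, zero_mul]
    rw [← e']
    exact mul_le_mul_of_nonneg_right (ha a) (G.chain_pow_nonneg ν _ _ _)
  · obtain ⟨k, hk, hpos⟩ := exists_le_chain_pow_pos hC s.2.2 t.2.2 T
    exact ⟨k, mul_pos (hT _ _ _ hk) hpos⟩

/-- The game restricted to a recurrent class has a uniform value which does not depend on the
initial state, and both players have stationary `ε`-optimal strategies. -/
theorem StronglyCommunicating₁.exists_uniform_value_restrict [Nonempty X] [MeasurableSpace Y]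
    [DiscreteMeasurableSpace Y] [∀ y, T2Space (B y)] (hG : G.StronglyCommunicating₁)
    {ν : (y : Y) → ProbabilityMeasure (B y)} {C : Finset Y}
    (hC : IsRecurrentClass (G.chain ν) C) :
    ∃ v ∈ Set.Icc (0 : ℝ) 1, ∀ ε : ℝ, 0 < ε →
      (∃ μ : X × C → ProbabilityMeasure A,
        ∀ s, (G.restrict C).IsOptimal₁ ε v s ((G.restrict C).stationary₁ μ)) ∧
      ∃ ν : (s : X × C) → ProbabilityMeasure (G.StayAction C s.2),
        ∀ s, (G.restrict C).IsOptimal₂ ε v s ((G.restrict C).stationary₂ ν) := by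
  have := nonempty_stayAction hC
  have : Nonempty C := hC.1.coe_sort
  obtain ⟨D, hD⟩ := (G.restrict C).exists_oscillation_bound (hG.exists_reach hC)
  exact (G.restrict C).exists_uniform_value hD

end Main

end ProductGame

end Restrict

theorem mainTheorem3 {X Y A B : Type*}
    [Fintype X] [Nonempty X] [MeasurableSpace X] [DiscreteMeasurableSpace X]
    [Fintype Y] [Nonempty Y] [DecidableEq Y] [MeasurableSpace Y] [DiscreteMeasurableSpace Y]
    [MetricSpace A] [CompactSpace A] [Nonempty A] [MeasurableSpace A] [BorelSpace A]
    [MetricSpace B] [CompactSpace B] [Nonempty B] [MeasurableSpace B] [BorelSpace B]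
    (G : ProductGame X Y A (fun _ => B)) (hG : G.StronglyCommunicating₁) :
    ∃ v : {C : Finset Y // G.IsMaximalCommunicating C} → ℝ,
      (∀ C, ∀ s : X × C.1, (G.restrict C.1).IsUniformValue s (v C)) ∧
      ∀ ε : ℝ, 0 < ε → ∃ N₀ : ℕ, 1 ≤ N₀ ∧ ∀ C,
        (∃ σ : (G.restrict C.1).Strategy₁, σ.IsMarkovPeriodic N₀ ∧
          ∀ s : X × C.1, (G.restrict C.1).IsOptimal₁ ε (v C) s σ) ∧
        (∃ τ : (G.restrict C.1).Strategy₂, τ.IsMarkovPeriodic N₀ ∧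
          ∀ s : X × C.1, (G.restrict C.1).IsOptimal₂ ε (v C) s τ) := by
  have h : ∀ C : {C : Finset Y // G.IsMaximalCommunicating C}, ∃ v ∈ Set.Icc (0 : ℝ) 1,
      ∀ ε : ℝ, 0 < ε →
      (∃ μ : X × C.1 → ProbabilityMeasure A,
        ∀ s, (G.restrict C.1).IsOptimal₁ ε v s ((G.restrict C.1).stationary₁ μ)) ∧
      ∃ ν : (s : X × C.1) → ProbabilityMeasure (G.StayAction C.1 s.2),
        ∀ s, (G.restrict C.1).IsOptimal₂ ε v s ((G.restrict C.1).stationary₂ ν) := by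
    rintro ⟨C, hC⟩
    obtain ⟨ν, hν⟩ := hC.prop
    exact hG.exists_uniform_value_restrict hν
  choose v hv hopt using h
  refine ⟨v, fun C s => ⟨hv C, fun ε hε => ?_, fun ε hε => ?_⟩, fun ε hε =>
    -- Stationary strategies have period 1, which is therefore common to all the classes.
    ⟨1, le_rfl, fun C => ⟨?_, ?_⟩⟩⟩
  · obtain ⟨⟨μ, hμ⟩, -⟩ := hopt C ε hε
    exact ⟨_, hμ s⟩
  · obtain ⟨-, ν, hν⟩ := hopt C ε hε
    exact ⟨_, hν s⟩
  · obtain ⟨⟨μ, hμ⟩, -⟩ := hopt C ε hε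
    exact ⟨_, (G.restrict C.1).isMarkovPeriodic_stationary₁ μ, hμ⟩
  · obtain ⟨-, ν, hν⟩ := hopt C ε hε
    exact ⟨_, (G.restrict C.1).isMarkovPeriodic_stationary₂ ν, hν⟩
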